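/- Let $\nu,\eta\in\mathbb R$ and consider, for $U=(u_1,u_2,u_3,u_4)^{T}\in\mathbb R^4$, the radial stationary Swift–Hohenberg system on the hyperbolic plane $$U_\tau=\mathcal A(\tau)U+\mathcal F(U,\lambda),\qquad \mathcal A(\tau)=\begin{pmatrix}0&0&1&0\\0&0&0&1\\-1&1&-\coth\tau&0\\0&-1&0&-\coth\tau\end{pmatrix},\quad \mathcal F(U,\lambda)=\begin{pmatrix}0\\0\\0\\ \lambda u_1+\nu u_1^2-\eta u_1^3\end{pmatrix}.\tag{1}$$ Let $\alpha_0=-\tfrac12+i\tfrac{\sqrt3}{2}$, and write $$P(\tau)=\mathcal P_{\alpha_0}(\cosh\tau),\quad P^1(\tau)=\mathcal P^1_{\alpha_0}(\cosh\tau),\quad Q(\tau)=\mathcal Q_{\alpha_0}(\cosh\tau),\quad Q^1(\tau)=\mathcal Q^1_{\alpha_0}(\cosh\tau).$$ Here $\mathcal P_{\alpha_0}(z)=\frac1\pi\int_0^\pi (z+\sqrt{z^2-1}\cos\theta)^{\alpha_0}d\theta$ is the (real-valued) Legendre function of the first kind, $\mathcal Q_{\alpha_0}(z)=\operatorname{Re}\int_0^\infty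 (z+\sqrt{z^2-1}\cosh t)^{-\alpha_0-1}dt$ is the real part of the Legendre function of the second kind, and $\mathcal P^1_{\alpha_0}(z)=\sqrt{z^2-1}\,\mathcal P_{\alpha_0}'(z)$, $\mathcal Q^1_{\alpha_0}(z)=\sqrt{z^2-1}\,\mathcal Q_{\alpha_0}'(z)$. With $$I_{PP}(\tau)=\int_0^\tau P^2\sinh s\,ds,\quad I_{PQ}(\tau)=\int_0^\tau PQ\sinh s\,ds,\quad I_{QQ}(\tau)=\int_0^\tau Q^2\sinh s\,ds,$$ put $$V_1=(P,0,P^1,0)^T,\quad V_2=(P I_{PQ}-Q I_{PP},\;P,\;P^1 I_{PQ}-Q^1 I_{PP},\;P^1)^T,$$ $$V_3=(Q,0,Q^1,0)^T,\quad V_4=(P I_{QQ}-Q I_{PQ},\;Q,\;P^1 I_{QQ}-Q^1 I_{PQ},\;Q^1)^T .$$ Then the integral $\mathcal I=\int_0^\infty P(s)^3\sinh s\,ds$ converges absolutely, and there are functions $\rho(\tau_0)\to0$ and $\varepsilon(\tau_0)\to0$ as $\tau_0\to\infty$ such that the following holds for every $\tau_0>0$. The vectors $V_1(\tau_0),\dots,V_4(\tau_0)$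 are linearly independent; let $P_-^{cu}(\tau_0)$ be the projection onto $\mathrm{span}\{V_1(\tau_0),V_2(\tau_0)\}$ with null space $\mathrm{span}\{V_3(\tau_0),V_4(\tau_0)\}$. There exist $\delta_0,\delta_1>0$, a constant $C$ (depending on $\tau_0$) and smooth functions $a,b$ of $(\tilde d,\lambda)=(\tilde d_1,\tilde d_2,\lambda)$ on $\{|\tilde d|<\delta_1,\ |\lambda|<\delta_0\}$ with the following properties. 1. For each $|\lambda|<\delta_0$, the set $$\mathcal W_-^{cu}(\lambda)=\Big\{U\in C^0([0,\tau_0],\mathbb R^4)\text{ solving (1) on }(0,\tau_0]\ :\ \sup_{0\le\tau\le\tau_0}|U(\tau)|<\delta_0\Big\}$$ is a smooth two-dimensional submanifold of $C^0([0,\tau_0],\mathbb R^4)$. 2. Let $|\lambda|<\delta_0$ and $|\tilde d|<\delta_1$. A solution $U\in C^0([0,\tau_0],\mathbb R^4)$ of (1) belongs to $\mathcal W_-^{cu}(\lambda)$ and satisfies $P_-^{cu}(\tau_0)U(\tau_0)=\tilde d_1V_1(\tau_0)+\tilde d_2V_2(\tau_0)$ if and only if $$U(\tau_0)=\tilde d_1V_1(\tau_0)+\tilde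 d_2V_2(\tau_0)+b(\tilde d,\lambda)\,V_3(\tau_0)+a(\tilde d,\lambda)\,V_4(\tau_0),\tag{2}$$ and there is a $U\in\mathcal W_-^{cu}(\lambda)$ satisfying (2). 3. For all $|\lambda|<\delta_0$ and $|\tilde d|<\delta_1$, $$|b(\tilde d,\lambda)|\le C\,(|\lambda||\tilde d|+|\tilde d|^2),$$ $$\big|a(\tilde d,\lambda)+(\mathcal I+\rho(\tau_0))\,\nu\,\tilde d_1^2\big|\le C\,\big(|\lambda||\tilde d|+|\tilde d_1||\tilde d_2|+|\tilde d_2|^2+|\tilde d_1|^3\big),$$ $$\big|a(\tilde d,\lambda)+\mathcal I\,\nu\,\tilde d_1^2\big|\le \varepsilon(\tau_0)\,|\nu|\,\tilde d_1^2+C\,\big(|\lambda||\tilde d|+|\tilde d_2|^2+|\tilde d_1|^3\big).$$ -/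

import Mathlib

open Set Filter Topology MeasureTheory
open scoped ContDiff

noncomputable section

namespace HyperbolicSH

/-- Legendre function of the first kind of complex degree `α`, at real `z ≥ 1`
(Laplace's first integral). -/
def legendreP (α : ℂ) (z : ℝ) : ℂ :=
  (1 / Real.pi : ℂ) * ∫ θ in (0 : ℝ)..Real.pi,
    ((z + Real.sqrt (z ^ 2 - 1) * Real.cos θ : ℝ) : ℂ) ^ α

/-- Legendre function of the second kind of complex degree `α` with `Re α > -1`, at real `z > 1`
(Heine's integral). -/
def legendreQ (α : ℂ) (z : ℝ) : ℂ :=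
  ∫ t in Ioi (0 : ℝ), ((z + Real.sqrt (z ^ 2 - 1) * Real.cosh t : ℝ) : ℂ) ^ (-α - 1)

/-- Associated Legendre function of the first kind of order one, at `z > 1`. -/
def legendreP1 (α : ℂ) (z : ℝ) : ℂ := (Real.sqrt (z ^ 2 - 1) : ℂ) * deriv (legendreP α) z

/-- Associated Legendre function of the second kind of order one, at `z > 1`. -/
def legendreQ1 (α : ℂ) (z : ℝ) : ℂ := (Real.sqrt (z ^ 2 - 1) : ℂ) * deriv (legendreQ α) z

/-- The degree `α₀ = -1/2 + i √3/2`, a root of `α (α + 1) = -1`. -/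
def alpha0 : ℂ := -1 / 2 + Complex.I * ((Real.sqrt 3 : ℝ) : ℂ) / 2

/-- `P_{α₀}(cosh τ)`. The complex number `legendreP alpha0 (cosh τ)` is real, so taking the real
part only changes the codomain. -/
def pc (τ : ℝ) : ℝ := (legendreP alpha0 (Real.cosh τ)).re

/-- `P¹_{α₀}(cosh τ)`. -/
def pc1 (τ : ℝ) : ℝ := (legendreP1 alpha0 (Real.cosh τ)).re

/-- `Q_{α₀}(cosh τ)`, in its real normalization: the real part of the Legendre function of the
second kind. -/
def qc (τ : ℝ) : ℝ := (legendreQ alpha0 (Real.cosh τ)).re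

/-- `Q¹_{α₀}(cosh τ)`, in the same real normalization. -/
def qc1 (τ : ℝ) : ℝ := (legendreQ1 alpha0 (Real.cosh τ)).re

/-- The phase space `ℝ⁴` with its Euclidean norm. -/
abbrev E4 := EuclideanSpace ℝ (Fin 4)

/-- The parameter space `ℝ²` with its Euclidean norm. -/
abbrev E2 := EuclideanSpace ℝ (Fin 2)

/-- `∫₀^τ P_{α₀}(cosh s)² sinh s ds`. -/
def intPP (τ : ℝ) : ℝ := ∫ s in (0 : ℝ)..τ, pc s ^ 2 * Real.sinh s

/-- `∫₀^τ P_{α₀}(cosh s) Q_{α₀}(cosh s) sinh s ds`. -/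
def intPQ (τ : ℝ) : ℝ := ∫ s in (0 : ℝ)..τ, pc s * qc s * Real.sinh s

/-- `∫₀^τ Q_{α₀}(cosh s)² sinh s ds`. -/
def intQQ (τ : ℝ) : ℝ := ∫ s in (0 : ℝ)..τ, qc s ^ 2 * Real.sinh s

def V1 (τ : ℝ) : E4 := !₂[pc τ, 0, pc1 τ, 0]

def V2 (τ : ℝ) : E4 :=
  !₂[pc τ * intPQ τ - qc τ * intPP τ, pc τ, pc1 τ * intPQ τ - qc1 τ * intPP τ, pc1 τ]

def V3 (τ : ℝ) : E4 := !₂[qc τ, 0, qc1 τ, 0]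

def V4 (τ : ℝ) : E4 :=
  !₂[pc τ * intQQ τ - qc τ * intPQ τ, qc τ, pc1 τ * intQQ τ - qc1 τ * intPQ τ, qc1 τ]

/-- The frame `V₁(τ), V₂(τ), V₃(τ), V₄(τ)`. -/
def frame (τ : ℝ) : Fin 4 → E4 := ![V1 τ, V2 τ, V3 τ, V4 τ]

/-- The matrix with columns `V₁(τ), …, V₄(τ)`. -/
def frameMatrix (τ : ℝ) : Matrix (Fin 4) (Fin 4) ℝ := Matrix.of fun i j => frame τ j i

/-- When `V₁(τ), …, V₄(τ)` are linearly independent: the projection of `ℝ⁴` onto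
`span {V₁(τ), V₂(τ)}` with null space `span {V₃(τ), V₄(τ)}`. -/
def coreProj (τ : ℝ) : E4 →ₗ[ℝ] E4 :=
  (frameMatrix τ * Matrix.diagonal ![1, 1, 0, 0] * (frameMatrix τ)⁻¹).toEuclideanLin

/-- The matrix `A(τ)` of the linear part, with `coth τ = cosh τ / sinh τ`. -/
def coreA (τ : ℝ) : Matrix (Fin 4) (Fin 4) ℝ :=
  !![0, 0, 1, 0;
     0, 0, 0, 1;
     -1, 1, -(Real.cosh τ / Real.sinh τ), 0;
     0, -1, 0, -(Real.cosh τ / Real.sinh τ)]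

/-- The nonlinear term `F(U, λ)`. -/
def coreF (ν η lam : ℝ) (u : E4) : E4 :=
  !₂[0, 0, 0, lam * u 0 + ν * u 0 ^ 2 - η * u 0 ^ 3]

/-- `U ∈ C⁰([0, τ₀], ℝ⁴)` solves `U' = A(τ) U + F(U, λ)` on `(0, τ₀]`
(the derivative at `τ₀` is one-sided). -/
def IsCoreSolution (ν η lam : ℝ) {τ₀ : ℝ} (h : 0 < τ₀) (U : C(Icc (0 : ℝ) τ₀, E4)) : Prop :=
  ∀ τ : Icc (0 : ℝ) τ₀, 0 < (τ : ℝ) →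
    HasDerivWithinAt (Set.IccExtend h.le U)
      ((coreA τ).toEuclideanLin (U τ) + coreF ν η lam (U τ)) (Icc 0 τ₀) τ

/-- The set `W^{cu}_-(λ)`: continuous solutions on `[0, τ₀]` with
`sup_{0 ≤ τ ≤ τ₀} |U(τ)| < δ₀`. -/
def coreManifold (ν η lam : ℝ) {τ₀ : ℝ} (h : 0 < τ₀) (δ₀ : ℝ) : Set C(Icc (0 : ℝ) τ₀, E4) :=
  {U | IsCoreSolution ν η lam h U ∧ ‖U‖ < δ₀}

/-- `S` is an `n`-dimensional embedded smooth submanifold of the normed space `X`: near each of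
its points it is the image of an open subset of `ℝⁿ` under a smooth immersion that is a
homeomorphism onto its image. -/
def IsSmoothSubmanifold {X : Type*} [NormedAddCommGroup X] [NormedSpace ℝ X]
    (n : ℕ) (S : Set X) : Prop :=
  ∀ p ∈ S, ∃ (O : Set X) (D : Set (EuclideanSpace ℝ (Fin n)))
    (φ : EuclideanSpace ℝ (Fin n) → X) (ψ : X → EuclideanSpace ℝ (Fin n)),
    IsOpen O ∧ p ∈ O ∧ IsOpen D ∧
    ContDiffOn ℝ ∞ φ D ∧ (∀ y ∈ D, Function.Injective (fderiv ℝ φ y)) ∧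
    φ '' D = S ∩ O ∧ ContinuousOn ψ (S ∩ O) ∧ (∀ y ∈ D, ψ (φ y) = y)

/-- `𝓘 = ∫₀^∞ P_{α₀}(cosh s)³ sinh s ds`. -/
def calI : ℝ := ∫ s in Ioi (0 : ℝ), pc s ^ 3 * Real.sinh s

end HyperbolicSH

end

/-!
The linear part of the system decouples into two Legendre equations `u'' + coth τ · u' = -u + F` in
triangular form, so variation of constants with the pair `P`, `Q` turns solving the system on
`(0, τ₀]` continuously up to `0` into a fixed-point equation between curves: the solution of the
forced linear equation that is regular at `0` is unique up to `x₁ V₁ + x₂ V₂`. Trading the values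
`x` at `0` for the coefficients `d` of `V₁(τ₀)` and `V₂(τ₀)` at the endpoint gives the equation
`U = T d + K (λ u₁ + ν u₁² - η u₁³)`, whose right-hand side is analytic, and the implicit function
theorem solves it by `U = Φ(d, λ)` near `0`.

The functions `b` and `a` are the coefficients of `V₃(τ₀)` and `V₄(τ₀)` in `Φ(d, λ)(τ₀)`. They
vanish on `T d`, hence see only the nonlinear term, and the coefficient of `V₄(τ₀)` in `(K f)(τ₀)`
is `-∫₀^τ₀ P f sinh`. With `u₁ ≈ d₁ P` this produces the term `-ν d₁² ∫₀^τ₀ P³ sinh` of `a`, and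
the integral converges as `τ₀ → ∞` because `P` decays like `τ e^(-τ/2)`, the degree `α₀` having real
part `-1/2`. Absorbing the mixed term `d₁ d₂` by Young's inequality with weight `1 / (1 + τ₀)` gives
the last estimate, at the price of a constant that depends on `τ₀`.
-/

noncomputable section

namespace HyperbolicSH

section RadialEquation

/-- `u` solves `u'' + coth τ · u' = κ u + F` at the positive points of `s`, where `v` stands for
`u'` and derivatives are taken within `s`. For radial functions on the hyperbolic plane the
left-hand side is the Laplacian. -/
def IsRadialSolutionOn {𝕜 : Type*} [RCLike 𝕜] (s : Set ℝ) (κ : 𝕜) (F u v : ℝ → 𝕜) : Prop :=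
  ∀ τ ∈ s, 0 < τ → HasDerivWithinAt u (v τ) s τ ∧
    HasDerivWithinAt v (κ * u τ - (Real.cosh τ / Real.sinh τ) • v τ + F τ) s τ

section Field

variable {𝕜 : Type*} [RCLike 𝕜] {s t : Set ℝ} {κ : 𝕜} {F G u v y w : ℝ → 𝕜}

theorem IsRadialSolutionOn.mono (hu : IsRadialSolutionOn t κ F u v) (hst : s ⊆ t) :
    IsRadialSolutionOn s κ F u v :=
  fun τ hτ hpos => ⟨(hu τ (hst hτ) hpos).1.mono hst, (hu τ (hst hτ) hpos).2.mono hst⟩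

theorem IsRadialSolutionOn.const_mul (hu : IsRadialSolutionOn s κ F u v) (a : 𝕜) :
    IsRadialSolutionOn s κ (fun τ => a * F τ) (fun τ => a * u τ) fun τ => a * v τ := by
  refine fun τ hτ hpos => ⟨(hu τ hτ hpos).1.const_mul a,
    ((hu τ hτ hpos).2.const_mul a).congr_deriv ?_⟩
  simp only [RCLike.real_smul_eq_coe_mul]
  ring

theorem IsRadialSolutionOn.add (hu : IsRadialSolutionOn s κ F u v)
    (hy : IsRadialSolutionOn s κ G y w) :
    IsRadialSolutionOn s κ (fun τ => F τ + G τ) (fun τ => u τ + y τ) fun τ => v τ + w τ := by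
  refine fun τ hτ hpos => ⟨(hu τ hτ hpos).1.add (hy τ hτ hpos).1,
    ((hu τ hτ hpos).2.add (hy τ hτ hpos).2).congr_deriv ?_⟩
  simp only [RCLike.real_smul_eq_coe_mul]
  ring

theorem IsRadialSolutionOn.congr (hu : IsRadialSolutionOn s κ F u v)
    (hy : ∀ τ ∈ s, 0 < τ → y τ = u τ) (hw : ∀ τ ∈ s, 0 < τ → w τ = v τ) :
    IsRadialSolutionOn s κ F y w := by
  intro τ hτ hpos
  have near {f g : ℝ → 𝕜} (hfg : ∀ t ∈ s, 0 < t → f t = g t) : f =ᶠ[𝓝[s] τ] g := by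
    filter_upwards [self_mem_nhdsWithin, mem_nhdsWithin_of_mem_nhds (lt_mem_nhds hpos)] with t hts
      ht using hfg t hts ht
  rw [hy τ hτ hpos, hw τ hτ hpos]
  exact ⟨(hu τ hτ hpos).1.congr_of_eventuallyEq (near hy) (hy τ hτ hpos),
    (hu τ hτ hpos).2.congr_of_eventuallyEq (near hw) (hw τ hτ hpos)⟩

end Field

theorem IsRadialSolutionOn.re {s : Set ℝ} {κ : ℝ} {F u v : ℝ → ℂ}
    (hu : IsRadialSolutionOn s (κ : ℂ) F u v) :
    IsRadialSolutionOn s κ (fun τ => (F τ).re) (fun τ => (u τ).re) fun τ => (v τ).re := by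
  have re_deriv {f : ℝ → ℂ} {f' : ℂ} {τ : ℝ} (hf : HasDerivWithinAt f f' s τ) :
      HasDerivWithinAt (fun t => (f t).re) f'.re s τ :=
    Complex.reCLM.hasFDerivAt.comp_hasDerivWithinAt τ hf
  refine fun τ hτ hpos => ⟨re_deriv (hu τ hτ hpos).1, (re_deriv (hu τ hτ hpos).2).congr_deriv ?_⟩
  rw [Complex.add_re, Complex.sub_re, Complex.re_ofReal_mul, Complex.smul_re]

variable {s : Set ℝ} {κ : ℝ} {F G u v y w : ℝ → ℝ}

theorem IsRadialSolutionOn.hasDerivAt (hu : IsRadialSolutionOn univ κ F u v) {τ : ℝ}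
    (hτ : 0 < τ) :
    HasDerivAt u (v τ) τ ∧
      HasDerivAt v (κ * u τ - Real.cosh τ / Real.sinh τ * v τ + F τ) τ := by
  simpa only [hasDerivWithinAt_univ, smul_eq_mul] using hu τ (mem_univ τ) hτ

theorem IsRadialSolutionOn.hasDerivWithinAt_wronskian (hu : IsRadialSolutionOn s κ F u v)
    (hy : IsRadialSolutionOn s κ G y w) {τ : ℝ} (hτ : τ ∈ s) (hpos : 0 < τ) :
    HasDerivWithinAt (fun t => Real.sinh t * (u t * w t - v t * y t))
      (Real.sinh τ * (u τ * G τ - F τ * y τ)) s τ := by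
  obtain ⟨hu, hv⟩ := hu τ hτ hpos
  obtain ⟨hy, hw⟩ := hy τ hτ hpos
  have hsinh : Real.sinh τ ≠ 0 := (Real.sinh_pos_iff.2 hpos).ne'
  refine ((Real.hasDerivAt_sinh τ).hasDerivWithinAt.mul
    ((hu.mul hw).sub (hv.mul hy))).congr_deriv ?_
  simp only [Pi.mul_apply, Pi.sub_apply, smul_eq_mul]
  field_simp
  ring

end RadialEquation

section FundamentalSystem

theorem eq_of_hasDerivWithinAt_zero_on_Ioc {f : ℝ → ℝ} {b : ℝ}
    (hf : ∀ x ∈ Ioc 0 b, HasDerivWithinAt f 0 (Icc 0 b) x) {x y : ℝ} (hx : x ∈ Ioc 0 b)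
    (hy : y ∈ Ioc 0 b) : f x = f y := by
  have := (convex_Ioc 0 b).norm_image_sub_le_of_norm_hasDerivWithin_le (C := 0)
    (fun z hz => (hf z hz).mono Ioc_subset_Icc_self) (by simp) hy hx
  simpa [sub_eq_zero] using this

theorem eqOn_Icc_of_eqOn_Ioc {X : Type*} [TopologicalSpace X] [T2Space X] {f g : ℝ → X} {a b : ℝ}
    (hab : a < b) (hf : ContinuousOn f (Icc a b)) (hg : ContinuousOn g (Icc a b))
    (h : EqOn f g (Ioc a b)) : EqOn f g (Icc a b) :=
  h.of_subset_closure hf hg Ioc_subset_Icc_self (by rw [closure_Ioc hab.ne])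

theorem exists_bound_Ioc_of_tendsto {f : ℝ → ℝ} {L : ℝ} (hf : ContinuousOn f (Ioi 0))
    (hL : Tendsto f (𝓝[>] 0) (𝓝 L)) (b : ℝ) : ∃ B, ∀ τ ∈ Ioc 0 b, |f τ| ≤ B := by
  have hcont : ContinuousOn (Function.update f 0 L) (Icc 0 b) := by
    refine (continuousOn_update_iff.2 ⟨?_, fun _ => ?_⟩).mono (Icc_subset_Ici_self)
    · rwa [Ici_sdiff_left]
    · rwa [Ici_sdiff_left]
  obtain ⟨B, hB⟩ := isCompact_Icc.exists_bound_of_continuousOn hcont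
  refine ⟨B, fun τ hτ => ?_⟩
  simpa [hτ.1.ne'] using hB τ (Ioc_subset_Icc_self hτ)

theorem hasDerivAt_integral_of_continuousOn_Ici {f : ℝ → ℝ} (hf : ContinuousOn f (Ici 0)) {τ : ℝ}
    (hτ : 0 < τ) : HasDerivAt (fun t => ∫ s in (0 : ℝ)..t, f s) (f τ) τ :=
  intervalIntegral.integral_hasDerivAt_right
    ((hf.mono Icc_subset_Ici_self).intervalIntegrable_of_Icc hτ.le)
    ((hf.mono Ioi_subset_Ici_self).stronglyMeasurableAtFilter isOpen_Ioi τ hτ)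
    (hf.continuousAt (Ici_mem_nhds hτ))

/-- A fundamental system of `u'' + coth τ · u' = κ u`: the solution `p` regular at `0` with
`p 0 = 1`, a solution `q` with the logarithmic singularity `q ∼ -log τ`, and their derivatives
`dp`, `dq`. -/
structure RadialSystem (κ : ℝ) where
  p : ℝ → ℝ
  dp : ℝ → ℝ
  q : ℝ → ℝ
  dq : ℝ → ℝ
  isRadialSolutionOn_p : IsRadialSolutionOn univ κ 0 p dp
  isRadialSolutionOn_q : IsRadialSolutionOn univ κ 0 q dq
  continuousOn_p : ContinuousOn p (Ici 0)
  continuousOn_dp : ContinuousOn dp (Ici 0)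
  p_zero : p 0 = 1
  tendsto_sinh_mul_q : Tendsto (fun τ => Real.sinh τ * q τ) (𝓝[>] 0) (𝓝 0)
  tendsto_sinh_mul_dq : Tendsto (fun τ => Real.sinh τ * dq τ) (𝓝[>] 0) (𝓝 (-1))

/-- The weighted integral `∫₀^τ w F sinh`; `sinh` is the density of the hyperbolic area in polar
coordinates. -/
def radialMoment (w F : ℝ → ℝ) (τ : ℝ) : ℝ := ∫ s in (0 : ℝ)..τ, w s * F s * Real.sinh s

section RadialMoment

variable {w F G : ℝ → ℝ} {τ : ℝ}

theorem continuousOn_radialMoment_integrand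
    (hw : ContinuousOn (fun s => w s * Real.sinh s) (Ici 0)) (hF : ContinuousOn F (Ici 0)) :
    ContinuousOn (fun s => w s * F s * Real.sinh s) (Ici 0) :=
  (hw.mul hF).congr fun s _ => by simp only [Pi.mul_apply]; ring

theorem hasDerivAt_radialMoment (hw : ContinuousOn (fun s => w s * Real.sinh s) (Ici 0))
    (hF : ContinuousOn F (Ici 0)) (hτ : 0 < τ) :
    HasDerivAt (radialMoment w F) (w τ * F τ * Real.sinh τ) τ :=
  hasDerivAt_integral_of_continuousOn_Ici (continuousOn_radialMoment_integrand hw hF) hτ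

theorem continuousOn_radialMoment (hw : ContinuousOn (fun s => w s * Real.sinh s) (Ici 0))
    (hF : ContinuousOn F (Ici 0)) (hτ : 0 ≤ τ) : ContinuousOn (radialMoment w F) (Icc 0 τ) := by
  rw [← uIcc_of_le hτ]
  refine intervalIntegral.continuousOn_primitive_interval (ContinuousOn.integrableOn_compact
    isCompact_uIcc ((continuousOn_radialMoment_integrand hw hF).mono ?_))
  rw [uIcc_of_le hτ]
  exact Icc_subset_Ici_self

theorem IsRadialSolutionOn.wronskian_sub_radialMoment_eq {κ b σ : ℝ} {dw u v : ℝ → ℝ}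
    (hw : IsRadialSolutionOn univ κ 0 w dw)
    (hsinh : ContinuousOn (fun s => w s * Real.sinh s) (Ici 0)) (hF : ContinuousOn F (Ici 0))
    (hu : IsRadialSolutionOn (Icc 0 b) κ F u v) (hτ : τ ∈ Ioc 0 b) (hσ : σ ∈ Ioc 0 b) :
    Real.sinh τ * (w τ * v τ - dw τ * u τ) - radialMoment w F τ =
      Real.sinh σ * (w σ * v σ - dw σ * u σ) - radialMoment w F σ := by
  refine eq_of_hasDerivWithinAt_zero_on_Ioc (f := fun t =>
    Real.sinh t * (w t * v t - dw t * u t) - radialMoment w F t) (fun t ht => ?_) hτ hσ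
  refine (((hw.mono (subset_univ _)).hasDerivWithinAt_wronskian hu (Ioc_subset_Icc_self ht)
    ht.1).sub (hasDerivAt_radialMoment hsinh hF ht.1).hasDerivWithinAt).congr_deriv ?_
  simp only [Pi.zero_apply]
  ring

theorem radialMoment_add (hw : ContinuousOn (fun s => w s * Real.sinh s) (Ici 0))
    (hF : ContinuousOn F (Ici 0)) (hG : ContinuousOn G (Ici 0)) (hτ : 0 ≤ τ) :
    radialMoment w (F + G) τ = radialMoment w F τ + radialMoment w G τ := by
  have integrable {f : ℝ → ℝ} (hf : ContinuousOn f (Ici 0)) :=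
    ((continuousOn_radialMoment_integrand hw hf).mono
      Icc_subset_Ici_self).intervalIntegrable_of_Icc (μ := volume) hτ
  rw [radialMoment, radialMoment, radialMoment,
    ← intervalIntegral.integral_add (integrable hF) (integrable hG)]
  exact intervalIntegral.integral_congr fun s _ => by simp only [Pi.add_apply]; ring

theorem radialMoment_smul (w : ℝ → ℝ) (c : ℝ) (F : ℝ → ℝ) (τ : ℝ) :
    radialMoment w (c • F) τ = c * radialMoment w F τ := by
  rw [radialMoment, radialMoment, ← intervalIntegral.integral_const_mul]
  exact intervalIntegral.integral_congr fun s _ => by simp only [Pi.smul_apply, smul_eq_mul]; ring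

theorem radialMoment_zero (w F : ℝ → ℝ) : radialMoment w F 0 = 0 :=
  intervalIntegral.integral_same

theorem abs_radialMoment_le {B m : ℝ} (hτ : 0 ≤ τ)
    (hw : ∀ s ∈ Icc 0 τ, |w s * Real.sinh s| ≤ B) (hF : ∀ s ∈ Icc 0 τ, |F s| ≤ m) :
    |radialMoment w F τ| ≤ B * m * τ := by
  have := intervalIntegral.norm_integral_le_of_norm_le_const (a := 0) (b := τ)
    (f := fun s => w s * F s * Real.sinh s) (C := B * m) fun s hs => by
      have hs : s ∈ Icc 0 τ := Ioc_subset_Icc_self (by rwa [uIoc_of_le hτ] at hs)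
      rw [mul_right_comm, norm_mul]
      exact mul_le_mul (hw s hs) (hF s hs) (abs_nonneg _) ((abs_nonneg _).trans (hw s hs))
  rwa [sub_zero, abs_of_nonneg hτ] at this

end RadialMoment

/-- The singularities allowed at `0` for a pair of coefficients `(x, y)` in variation of constants:
`x` is continuous up to `0` and `y` is at most of the order of `1 / τ`. -/
structure IsDuhamelPair (x y : ℝ → ℝ) : Prop where
  continuousOn_fst : ContinuousOn x (Ici 0)
  continuousOn_snd : ContinuousOn y (Ioi 0)
  exists_tendsto_sinh_mul_snd : ∃ L, Tendsto (fun τ => Real.sinh τ * y τ) (𝓝[>] 0) (𝓝 L)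

theorem IsDuhamelPair.exists_bound {x y : ℝ → ℝ} (hxy : IsDuhamelPair x y) (b : ℝ) :
    ∃ B, ∀ τ ∈ Icc 0 b, |x τ| ≤ B ∧ |y τ * Real.sinh τ| ≤ B := by
  obtain ⟨L, hL⟩ := hxy.exists_tendsto_sinh_mul_snd
  obtain ⟨B, hB⟩ := exists_bound_Ioc_of_tendsto
    (Real.continuous_sinh.continuousOn.mul hxy.continuousOn_snd) hL b
  obtain ⟨B', hB'⟩ := isCompact_Icc.exists_bound_of_continuousOn
    (hxy.continuousOn_fst.mono (Icc_subset_Ici_self (b := 0) (a := b)))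
  refine ⟨max B B', fun τ hτ => ⟨(hB' τ hτ).trans (le_max_right _ _), ?_⟩⟩
  rcases hτ.1.eq_or_lt with rfl | hpos
  · simpa using .inr ((abs_nonneg _).trans (hB' 0 hτ))
  · rw [mul_comm]
    exact (hB τ ⟨hpos, hτ.2⟩).trans (le_max_left _ _)

namespace RadialSystem

variable {κ : ℝ} (S : RadialSystem κ)

theorem continuousOn_q : ContinuousOn S.q (Ioi 0) := fun _ hτ =>
  (S.isRadialSolutionOn_q.hasDerivAt hτ).1.continuousAt.continuousWithinAt

theorem continuousOn_dq : ContinuousOn S.dq (Ioi 0) := fun _ hτ =>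
  (S.isRadialSolutionOn_q.hasDerivAt hτ).2.continuousAt.continuousWithinAt

theorem sinh_mul_wronskian {τ : ℝ} (hτ : 0 < τ) :
    Real.sinh τ * (S.dp τ * S.q τ - S.p τ * S.dq τ) = 1 := by
  set W : ℝ → ℝ := fun t => Real.sinh t * (S.p t * S.dq t - S.dp t * S.q t) with hW
  have hderiv : ∀ t ∈ Ioi (0 : ℝ), HasDerivAt W 0 t := fun t ht => by
    simpa [hasDerivWithinAt_univ] using S.isRadialSolutionOn_p.hasDerivWithinAt_wronskian
      S.isRadialSolutionOn_q (mem_univ t) ht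
  have hconst : ∀ t ∈ Ioi (0 : ℝ), W t = W τ := fun t ht =>
    isOpen_Ioi.is_const_of_deriv_eq_zero isPreconnected_Ioi
      (fun x hx => (hderiv x hx).differentiableAt.differentiableWithinAt)
      (fun x hx => (hderiv x hx).deriv) ht hτ
  have hlim : Tendsto W (𝓝[>] 0) (𝓝 (-1)) := by
    have hp := (S.continuousOn_p 0 self_mem_Ici).mono_left (nhdsWithin_mono 0 Ioi_subset_Ici_self)
    have hdp := (S.continuousOn_dp 0 self_mem_Ici).mono_left
      (nhdsWithin_mono 0 Ioi_subset_Ici_self)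
    refine ((hp.mul S.tendsto_sinh_mul_dq).sub (hdp.mul S.tendsto_sinh_mul_q)).congr'
      (.of_forall fun t => ?_) |>.trans_eq ?_
    · simp only [hW]; ring
    · simp [S.p_zero]
  have hWτ : W τ = -1 := tendsto_nhds_unique
    (tendsto_const_nhds.congr'
      (eventually_nhdsWithin_of_forall fun t ht => (hconst t ht).symm)) hlim
  simp only [hW] at hWτ
  linear_combination -hWτ

theorem continuousOn_q_mul_sinh : ContinuousOn (fun τ => S.q τ * Real.sinh τ) (Ici 0) := by
  intro τ hτ
  rcases (mem_Ici.1 hτ).eq_or_lt with rfl | hpos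
  · rw [← continuousWithinAt_sdiff_self, Ici_sdiff_left]
    simpa [ContinuousWithinAt, mul_comm] using S.tendsto_sinh_mul_q
  · exact ((S.isRadialSolutionOn_q.hasDerivAt hpos).1.continuousAt.mul
      Real.continuous_sinh.continuousAt).continuousWithinAt

theorem continuousOn_p_mul_sinh : ContinuousOn (fun τ => S.p τ * Real.sinh τ) (Ici 0) :=
  S.continuousOn_p.mul Real.continuous_sinh.continuousOn

theorem isDuhamelPair : IsDuhamelPair S.p S.q :=
  ⟨S.continuousOn_p, S.continuousOn_q, 0, S.tendsto_sinh_mul_q⟩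

theorem isDuhamelPair_deriv : IsDuhamelPair S.dp S.dq :=
  ⟨S.continuousOn_dp, S.continuousOn_dq, -1, S.tendsto_sinh_mul_dq⟩

/-- The Duhamel integral `x ∫₀^τ q F sinh - y ∫₀^τ p F sinh`. For `(x, y) = (p, q)` it is the
solution of `u'' + coth τ · u' = κ u + F` which vanishes with its derivative at `0`, and
`(x, y) = (dp, dq)` gives its derivative. -/
def duhamel (x y F : ℝ → ℝ) (τ : ℝ) : ℝ :=
  x τ * radialMoment S.q F τ - y τ * radialMoment S.p F τ

theorem isRadialSolutionOn_duhamel (s : Set ℝ) {F : ℝ → ℝ} (hF : ContinuousOn F (Ici 0)) :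
    IsRadialSolutionOn s κ F (S.duhamel S.p S.q F) (S.duhamel S.dp S.dq F) := by
  intro τ _ hpos
  obtain ⟨hp, hdp⟩ := S.isRadialSolutionOn_p.hasDerivAt hpos
  obtain ⟨hq, hdq⟩ := S.isRadialSolutionOn_q.hasDerivAt hpos
  have hP := hasDerivAt_radialMoment S.continuousOn_p_mul_sinh hF hpos
  have hQ := hasDerivAt_radialMoment S.continuousOn_q_mul_sinh hF hpos
  constructor
  · refine (((hp.mul hQ).sub (hq.mul hP)).congr_deriv ?_).hasDerivWithinAt
    simp only [duhamel]
    ring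
  · refine (((hdp.mul hQ).sub (hdq.mul hP)).congr_deriv ?_).hasDerivWithinAt
    simp only [duhamel, Pi.zero_apply, smul_eq_mul]
    linear_combination F τ * S.sinh_mul_wronskian hpos

section Duhamel

variable {x y F : ℝ → ℝ} {b : ℝ}

theorem duhamel_zero (x y F : ℝ → ℝ) : S.duhamel x y F 0 = 0 := by
  simp only [duhamel, radialMoment_zero, mul_zero, sub_zero]

theorem exists_abs_duhamel_le (hxy : IsDuhamelPair x y) (b : ℝ) :
    ∃ C, 0 ≤ C ∧ ∀ {F : ℝ → ℝ} {m : ℝ}, (∀ τ ∈ Icc 0 b, |F τ| ≤ m) →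
      ∀ τ ∈ Icc 0 b, |S.duhamel x y F τ| ≤ C * m * τ := by
  obtain ⟨A, hA⟩ := hxy.exists_bound b
  obtain ⟨B, hB⟩ := S.isDuhamelPair.exists_bound b
  refine ⟨2 * (|A| * |B|), by positivity, fun {F m} hm τ hτ => ?_⟩
  have hm0 : 0 ≤ m := (abs_nonneg _).trans (hm τ hτ)
  have hsub : Icc 0 τ ⊆ Icc 0 b := Icc_subset_Icc_right hτ.2
  have hτ0 := hτ.1
  have hsinh := Real.sinh_nonneg_iff.2 hτ.1
  have hQ : |radialMoment S.q F τ| ≤ |B| * m * τ := abs_radialMoment_le hτ.1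
    (fun s hs => (hB s (hsub hs)).2.trans (le_abs_self B)) fun s hs => hm s (hsub hs)
  have hP : |radialMoment S.p F τ| ≤ |B| * Real.sinh τ * m * τ := by
    refine abs_radialMoment_le hτ.1 (fun s hs => ?_) fun s hs => hm s (hsub hs)
    rw [abs_mul, abs_of_nonneg (Real.sinh_nonneg_iff.2 hs.1)]
    have := Real.sinh_nonneg_iff.2 hs.1
    exact mul_le_mul ((hB s (hsub hs)).1.trans (le_abs_self B)) (Real.sinh_le_sinh.2 hs.2) this
      (abs_nonneg B)
  have hx : |x τ| ≤ |A| := (hA τ hτ).1.trans (le_abs_self A)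
  have hy : |y τ| * Real.sinh τ ≤ |A| := by
    simpa [abs_mul, abs_of_nonneg hsinh] using (hA τ hτ).2.trans (le_abs_self A)
  calc |S.duhamel x y F τ|
      ≤ |x τ| * |radialMoment S.q F τ| + |y τ| * |radialMoment S.p F τ| := by
        rw [← abs_mul, ← abs_mul]; exact abs_sub _ _
    _ ≤ |A| * (|B| * m * τ) + |y τ| * (|B| * Real.sinh τ * m * τ) := by gcongr
    _ = |A| * (|B| * m * τ) + |y τ| * Real.sinh τ * (|B| * m * τ) := by ring
    _ ≤ |A| * (|B| * m * τ) + |A| * (|B| * m * τ) := by gcongr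
    _ = 2 * (|A| * |B|) * m * τ := by ring

theorem continuousOn_duhamel (hxy : IsDuhamelPair x y) (hF : ContinuousOn F (Ici 0)) :
    ContinuousOn (S.duhamel x y F) (Icc 0 b) := by
  intro τ hτ
  rcases hτ.1.eq_or_lt with rfl | hpos
  · obtain ⟨C, -, hC⟩ := S.exists_abs_duhamel_le hxy b
    obtain ⟨m, hm⟩ := isCompact_Icc.exists_bound_of_continuousOn
      (hF.mono (Icc_subset_Ici_self (b := 0) (a := b)))
    have hlim : Tendsto (fun τ : ℝ => C * m * τ) (𝓝[Icc 0 b] 0) (𝓝 0) := by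
      have : Continuous fun τ : ℝ => C * m * τ := by fun_prop
      simpa using (this.tendsto 0).mono_left nhdsWithin_le_nhds
    rw [ContinuousWithinAt, duhamel_zero]
    exact squeeze_zero_norm' (eventually_mem_nhdsWithin.mono (hC hm)) hlim
  · have hx := hxy.continuousOn_fst.continuousAt (Ici_mem_nhds hpos)
    have hy := hxy.continuousOn_snd.continuousAt (Ioi_mem_nhds hpos)
    exact ((hx.mul (hasDerivAt_radialMoment S.continuousOn_q_mul_sinh hF hpos).continuousAt).sub
      (hy.mul (hasDerivAt_radialMoment
        S.continuousOn_p_mul_sinh hF hpos).continuousAt)).continuousWithinAt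

theorem duhamel_add {F G : ℝ → ℝ} (x y : ℝ → ℝ) (hF : ContinuousOn F (Ici 0))
    (hG : ContinuousOn G (Ici 0)) {τ : ℝ} (hτ : 0 ≤ τ) :
    S.duhamel x y (F + G) τ = S.duhamel x y F τ + S.duhamel x y G τ := by
  simp only [duhamel, radialMoment_add S.continuousOn_q_mul_sinh hF hG hτ,
    radialMoment_add S.continuousOn_p_mul_sinh hF hG hτ]
  ring

theorem duhamel_smul (x y : ℝ → ℝ) (c : ℝ) (F : ℝ → ℝ) (τ : ℝ) :
    S.duhamel x y (c • F) τ = c * S.duhamel x y F τ := by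
  simp only [duhamel, radialMoment_smul]
  ring

/-- The Duhamel integral as a bounded operator on `C([0, b])`; the forcing is extended to the line
by constants. -/
def duhamelOp (hxy : IsDuhamelPair x y) (hb : 0 ≤ b) :
    C(Icc (0 : ℝ) b, ℝ) →L[ℝ] C(Icc (0 : ℝ) b, ℝ) :=
  LinearMap.mkContinuousOfExistsBound
    { toFun := fun f => ⟨fun τ => S.duhamel x y (IccExtend hb f) τ,
        continuousOn_iff_continuous_domRestrict.1
          (S.continuousOn_duhamel hxy f.continuous.Icc_extend'.continuousOn)⟩
      map_add' := fun f g => by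
        ext τ
        exact S.duhamel_add x y f.continuous.Icc_extend'.continuousOn
          g.continuous.Icc_extend'.continuousOn τ.2.1
      map_smul' := fun c f => by
        ext τ
        exact S.duhamel_smul x y c (IccExtend hb f) τ } <| by
    obtain ⟨C, hC0, hC⟩ := S.exists_abs_duhamel_le hxy b
    refine ⟨C * b, fun f => (ContinuousMap.norm_le _ (by positivity)).2 fun τ => ?_⟩
    calc |S.duhamel x y (IccExtend hb f) τ| ≤ C * ‖f‖ * τ :=
          hC (fun t _ => f.norm_coe_le_norm _) τ τ.2
      _ ≤ C * ‖f‖ * b := by gcongr; exact τ.2.2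
      _ = C * b * ‖f‖ := by ring

end Duhamel

section Representation

variable {F u v : ℝ → ℝ} {b : ℝ}

/- Green's identity against `p` has no boundary term at `0`, because `u` and `v` are bounded there;
against `q` it leaves a constant, the coefficient `c`. -/
theorem exists_eq_const_mul_add_duhamel (hb : 0 < b) (hF : ContinuousOn F (Ici 0))
    (hu : ContinuousOn u (Icc 0 b)) (hv : ContinuousOn v (Icc 0 b))
    (hsol : IsRadialSolutionOn (Icc 0 b) κ F u v) :
    ∃ c, EqOn u (fun τ => c * S.p τ + S.duhamel S.p S.q F τ) (Icc 0 b) ∧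
      EqOn v (fun τ => c * S.dp τ + S.duhamel S.dp S.dq F τ) (Icc 0 b) := by
  have hbb : b ∈ Ioc 0 b := ⟨hb, le_rfl⟩
  have hp := S.continuousOn_p.mono (Icc_subset_Ici_self (b := 0) (a := b))
  have hdp := S.continuousOn_dp.mono (Icc_subset_Ici_self (b := 0) (a := b))
  obtain ⟨c₀, hc₀⟩ : ∃ c₀, EqOn (fun t => Real.sinh t * (S.p t * v t - S.dp t * u t))
      (fun t => radialMoment S.p F t + c₀) (Ioc 0 b) :=
    ⟨_, fun t ht => eq_add_of_sub_eq' (S.isRadialSolutionOn_p.wronskian_sub_radialMoment_eq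
      S.continuousOn_p_mul_sinh hF hsol ht hbb)⟩
  obtain ⟨c, hc⟩ : ∃ c, EqOn (fun t => Real.sinh t * (S.q t * v t - S.dq t * u t))
      (fun t => radialMoment S.q F t + c) (Ioc 0 b) :=
    ⟨_, fun t ht => eq_add_of_sub_eq' (S.isRadialSolutionOn_q.wronskian_sub_radialMoment_eq
      S.continuousOn_q_mul_sinh hF hsol ht hbb)⟩
  have no_boundary_term : c₀ = 0 := by
    have := eqOn_Icc_of_eqOn_Ioc hb
      (Real.continuous_sinh.continuousOn.mul ((hp.mul hv).sub (hdp.mul hu)))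
      ((continuousOn_radialMoment S.continuousOn_p_mul_sinh hF hb.le).add continuousOn_const)
      hc₀ (left_mem_Icc.2 hb.le)
    simpa [radialMoment_zero] using this.symm
  refine ⟨c, eqOn_Icc_of_eqOn_Ioc hb hu ((hp.const_smul c).add
      (S.continuousOn_duhamel S.isDuhamelPair hF)) fun t ht => ?_,
    eqOn_Icc_of_eqOn_Ioc hb hv ((hdp.const_smul c).add
      (S.continuousOn_duhamel S.isDuhamelPair_deriv hF)) fun t ht => ?_⟩
  · have h₀ := hc₀ ht
    have h₁ := hc ht
    simp only [no_boundary_term, duhamel] at h₀ h₁ ⊢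
    linear_combination S.p t * h₁ - S.q t * h₀ - u t * S.sinh_mul_wronskian ht.1
  · have h₀ := hc₀ ht
    have h₁ := hc ht
    simp only [no_boundary_term, duhamel] at h₀ h₁ ⊢
    linear_combination S.dp t * h₁ - S.dq t * h₀ - v t * S.sinh_mul_wronskian ht.1

end Representation

end RadialSystem

end FundamentalSystem

section Decay

/-- The energy `w'² + (-κ - 1/4 + 1 / (4 sinh²)) w²` of `w = √sinh · u`, where `v = u'`. If
`u'' + coth τ · u' = κ u` then `w'' + (-κ - 1/4 + 1 / (4 sinh²)) w = 0`, whose potential is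
decreasing. -/
def radialEnergy (κ : ℝ) (u v : ℝ → ℝ) (τ : ℝ) : ℝ :=
  Real.sinh τ * (v τ + Real.cosh τ / (2 * Real.sinh τ) * u τ) ^ 2 +
    (-κ - 1 / 4 + 1 / (4 * Real.sinh τ ^ 2)) * (Real.sinh τ * u τ ^ 2)

variable {κ : ℝ} {u v : ℝ → ℝ}

theorem IsRadialSolutionOn.hasDerivAt_radialEnergy (hu : IsRadialSolutionOn univ κ 0 u v) {τ : ℝ}
    (hτ : 0 < τ) :
    HasDerivAt (radialEnergy κ u v) (-(Real.cosh τ * u τ ^ 2 / (2 * Real.sinh τ ^ 2))) τ := by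
  obtain ⟨hu', hv'⟩ := hu.hasDerivAt hτ
  have hsinh : Real.sinh τ ≠ 0 := (Real.sinh_pos_iff.2 hτ).ne'
  have hs := Real.hasDerivAt_sinh τ
  have hc := Real.hasDerivAt_cosh τ
  refine ((hs.mul ((hv'.add ((hc.div (hs.const_mul 2) (mul_ne_zero two_ne_zero hsinh)).mul
      hu')).pow 2)).add
    ((((hasDerivAt_const τ (1 : ℝ)).div ((hs.pow 2).const_mul 4)
      (mul_ne_zero four_ne_zero (pow_ne_zero 2 hsinh))).const_add
      (-κ - 1 / 4)).mul (hs.mul (hu'.pow 2)))).congr_deriv ?_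
  simp only [Pi.mul_apply, Pi.add_apply, Pi.pow_apply, Pi.div_apply, Pi.zero_apply,
    Nat.add_one_sub_one, pow_one, Nat.cast_ofNat]
  field_simp
  have := Real.cosh_sq τ
  generalize Real.cosh τ = C at *
  generalize Real.sinh τ = S at *
  linear_combination (-8 * S * v τ * u τ - 4 * C * u τ ^ 2) * this

theorem IsRadialSolutionOn.sinh_mul_sq_le (hu : IsRadialSolutionOn univ κ 0 u v)
    (hκ : κ < -1 / 4) {τ : ℝ} (hτ : 1 ≤ τ) :
    Real.sinh τ * u τ ^ 2 ≤ radialEnergy κ u v 1 / (-κ - 1 / 4) := by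
  have hanti : AntitoneOn (radialEnergy κ u v) (Ioi 0) := by
    refine antitoneOn_of_deriv_nonpos (convex_Ioi 0)
      (fun x hx => (hu.hasDerivAt_radialEnergy hx).continuousAt.continuousWithinAt)
      (fun x hx => ?_) (fun x hx => ?_) <;> rw [interior_Ioi] at hx
    · exact (hu.hasDerivAt_radialEnergy hx).differentiableAt.differentiableWithinAt
    · rw [(hu.hasDerivAt_radialEnergy hx).deriv, neg_nonpos]
      have := Real.cosh_pos x
      positivity
  have hpos : 0 < τ := by linarith
  have _ := Real.sinh_pos_iff.2 hpos
  rw [le_div_iff₀' (by linarith)]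
  calc (-κ - 1 / 4) * (Real.sinh τ * u τ ^ 2)
      ≤ (-κ - 1 / 4 + 1 / (4 * Real.sinh τ ^ 2)) * (Real.sinh τ * u τ ^ 2) := by
        gcongr
        exact le_add_of_nonneg_right (by positivity)
    _ ≤ radialEnergy κ u v τ := le_add_of_nonneg_left (by positivity)
    _ ≤ radialEnergy κ u v 1 := hanti (mem_Ioi.2 one_pos) (mem_Ioi.2 hpos) hτ

theorem exp_div_four_le_sinh {s : ℝ} (hs : 1 ≤ s) : Real.exp s / 4 ≤ Real.sinh s := by
  have hone : Real.exp (-s) * Real.exp s = 1 := by rw [← Real.exp_add]; simp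
  rw [Real.sinh_eq]
  nlinarith [Real.add_one_le_exp s, Real.exp_pos (-s)]

theorem IsRadialSolutionOn.exists_abs_le_exp (hu : IsRadialSolutionOn univ κ 0 u v)
    (hκ : κ < -1 / 4) : ∃ C, ∀ s, 1 ≤ s → |u s| ≤ C * Real.exp (-s / 2) := by
  set M := radialEnergy κ u v 1 / (-κ - 1 / 4)
  refine ⟨Real.sqrt (4 * M), fun s hs => ?_⟩
  have hexp : Real.exp s * u s ^ 2 ≤ 4 * M := by
    nlinarith [hu.sinh_mul_sq_le hκ hs, exp_div_four_le_sinh hs, sq_nonneg (u s)]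
  have hsq : Real.exp (-s / 2) ^ 2 * Real.exp s = 1 := by
    rw [← Real.exp_nat_mul, ← Real.exp_add, Nat.cast_ofNat, mul_div_cancel₀ _ two_ne_zero,
      neg_add_cancel, Real.exp_zero]
  refine abs_le_of_sq_le_sq ?_ (by positivity)
  rw [mul_pow, Real.sq_sqrt ((by positivity : (0 : ℝ) ≤ _).trans hexp)]
  calc u s ^ 2 = Real.exp s * u s ^ 2 * Real.exp (-s / 2) ^ 2 := by
        linear_combination -u s ^ 2 * hsq
    _ ≤ 4 * M * Real.exp (-s / 2) ^ 2 := by gcongr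

theorem IsRadialSolutionOn.integrableOn_pow_mul_sinh (hu : IsRadialSolutionOn univ κ 0 u v)
    (hκ : κ < -1 / 4) (hcont : ContinuousOn u (Ici 0)) {n : ℕ} (hn : 2 < n) :
    IntegrableOn (fun s => u s ^ n * Real.sinh s) (Ioi 0) := by
  have hcont : ContinuousOn (fun s => u s ^ n * Real.sinh s) (Ici 0) :=
    (hcont.pow n).mul Real.continuous_sinh.continuousOn
  obtain ⟨C, hC⟩ := hu.exists_abs_le_exp hκ
  have hn' : (0 : ℝ) < n / 2 - 1 := by
    have : (2 : ℝ) < n := by exact_mod_cast hn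
    linarith
  rw [← Ioc_union_Ioi_eq_Ioi zero_le_one, integrableOn_union]
  refine ⟨(hcont.mono Icc_subset_Ici_self).integrableOn_Icc.mono_set Ioc_subset_Icc_self,
    ((exp_neg_integrableOn_Ioi 1 hn').const_mul (C ^ n)).mono'
      ((hcont.mono (Ioi_subset_Ici zero_le_one)).aestronglyMeasurable measurableSet_Ioi)
      ((ae_restrict_iff' measurableSet_Ioi).2 (.of_forall fun s (hs : 1 < s) => ?_))⟩
  have hsinh : |Real.sinh s| ≤ Real.exp s := by
    rw [abs_of_pos (Real.sinh_pos_iff.2 (by linarith)), Real.sinh_eq]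
    linarith [Real.exp_pos s, Real.exp_pos (-s)]
  have hu_le := hC s hs.le
  have hbound_nonneg := (abs_nonneg _).trans hu_le
  calc ‖u s ^ n * Real.sinh s‖ = |u s| ^ n * |Real.sinh s| := by rw [norm_mul, norm_pow]; rfl
    _ ≤ (C * Real.exp (-s / 2)) ^ n * Real.exp s := by gcongr
    _ = C ^ n * Real.exp (-(n / 2 - 1) * s) := by
      rw [mul_pow, ← Real.exp_nat_mul, mul_assoc, ← Real.exp_add]
      congr 2
      ring

end Decay

section LaplaceKernel

/-- The base `cosh τ + sinh τ · c` of the Laplace-type integrands of the Legendre functions. -/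
def laplaceBase (c τ : ℝ) : ℝ := Real.cosh τ + Real.sinh τ * c

/-- The `τ`-derivative of `laplaceBase`. -/
def laplaceBaseDeriv (c τ : ℝ) : ℝ := Real.sinh τ + Real.cosh τ * c

/-- The Laplace-type integrand `(cosh τ + sinh τ · c) ^ β`. -/
def laplaceKernel (β : ℂ) (c τ : ℝ) : ℂ := (laplaceBase c τ : ℂ) ^ β

/-- The `τ`-derivative of `laplaceKernel`. -/
def laplaceKernelDeriv (β : ℂ) (c τ : ℝ) : ℂ :=
  β * laplaceKernel β c τ * ((laplaceBaseDeriv c τ / laplaceBase c τ : ℝ) : ℂ)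

/-- The second `τ`-derivative of `laplaceKernel`. -/
def laplaceKernelDeriv₂ (β : ℂ) (c τ : ℝ) : ℂ :=
  β * laplaceKernel β c τ *
    ((β - 1) * ((laplaceBaseDeriv c τ / laplaceBase c τ : ℝ) : ℂ) ^ 2 + 1)

/-- The defect of `laplaceKernel β c` in the radial form of Legendre's equation of degree `β`. -/
def legendreDefect (β : ℂ) (c τ : ℝ) : ℂ :=
  laplaceKernelDeriv₂ β c τ
    + ((Real.cosh τ / Real.sinh τ : ℝ) : ℂ) * laplaceKernelDeriv β c τ
    - β * (β + 1) * laplaceKernel β c τ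

variable {β : ℂ} {τ : ℝ}

theorem hasDerivAt_laplaceBase (c τ : ℝ) :
    HasDerivAt (laplaceBase c) (laplaceBaseDeriv c τ) τ :=
  (Real.hasDerivAt_cosh τ).add ((Real.hasDerivAt_sinh τ).mul_const c)

theorem hasDerivAt_laplaceBaseDeriv (c τ : ℝ) :
    HasDerivAt (laplaceBaseDeriv c) (laplaceBase c τ) τ :=
  (Real.hasDerivAt_sinh τ).add ((Real.hasDerivAt_cosh τ).mul_const c)

theorem hasDerivAt_ofReal_cpow_const {f : ℝ → ℝ} {f' x : ℝ} (β : ℂ) (hf : HasDerivAt f f' x)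
    (hx : 0 < f x) :
    HasDerivAt (fun y => (f y : ℂ) ^ β) (β * (f x : ℂ) ^ β * ((f' / f x : ℝ) : ℂ)) x := by
  have hpow := (hasDerivAt_id (f x : ℂ)).cpow_const (c := β) (Or.inl (by simpa using hx))
  refine (hpow.comp x hf.ofReal_comp).congr_deriv ?_
  have hne : (f x : ℂ) ≠ 0 := by exact_mod_cast hx.ne'
  simp only [id, Complex.cpow_sub _ _ hne, Complex.cpow_one]
  push_cast
  field_simp

theorem norm_laplaceKernel (β : ℂ) {c : ℝ} (h : 0 < laplaceBase c τ) :
    ‖laplaceKernel β c τ‖ = laplaceBase c τ ^ β.re :=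
  Complex.norm_cpow_eq_rpow_re_of_pos h β

theorem hasDerivAt_laplaceKernel (β : ℂ) {c : ℝ} (h : 0 < laplaceBase c τ) :
    HasDerivAt (laplaceKernel β c) (laplaceKernelDeriv β c τ) τ :=
  hasDerivAt_ofReal_cpow_const β (hasDerivAt_laplaceBase c τ) h

theorem hasDerivAt_laplaceKernelDeriv (β : ℂ) {c : ℝ} (h : 0 < laplaceBase c τ) :
    HasDerivAt (laplaceKernelDeriv β c) (laplaceKernelDeriv₂ β c τ) τ := by
  have hratio :=
    ((hasDerivAt_laplaceBaseDeriv c τ).div (hasDerivAt_laplaceBase c τ) h.ne').ofReal_comp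
  refine (((hasDerivAt_laplaceKernel β h).const_mul β).mul hratio).congr_deriv ?_
  have hne : (laplaceBase c τ : ℂ) ≠ 0 := by exact_mod_cast h.ne'
  simp only [laplaceKernelDeriv₂, laplaceKernelDeriv, Pi.div_apply]
  push_cast
  field_simp
  ring

theorem norm_laplaceBaseDeriv_div_le {c K : ℝ} (h : 0 < laplaceBase c τ)
    (hK : |laplaceBaseDeriv c τ| ≤ K * laplaceBase c τ) :
    ‖((laplaceBaseDeriv c τ / laplaceBase c τ : ℝ) : ℂ)‖ ≤ K := by
  rwa [Complex.norm_real, Real.norm_eq_abs, abs_div, abs_of_pos h, div_le_iff₀ h]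

theorem norm_laplaceKernelDeriv_le (β : ℂ) {c K : ℝ} (h : 0 < laplaceBase c τ)
    (hK : |laplaceBaseDeriv c τ| ≤ K * laplaceBase c τ) :
    ‖laplaceKernelDeriv β c τ‖ ≤ ‖β‖ * laplaceBase c τ ^ β.re * K := by
  rw [laplaceKernelDeriv, norm_mul, norm_mul, norm_laplaceKernel β h]
  have := Real.rpow_nonneg h.le β.re
  gcongr
  exact norm_laplaceBaseDeriv_div_le h hK

theorem norm_laplaceKernelDeriv₂_le (β : ℂ) {c K : ℝ} (h : 0 < laplaceBase c τ)
    (hK : |laplaceBaseDeriv c τ| ≤ K * laplaceBase c τ) :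
    ‖laplaceKernelDeriv₂ β c τ‖ ≤ ‖β‖ * laplaceBase c τ ^ β.re * (‖β - 1‖ * K ^ 2 + 1) := by
  rw [laplaceKernelDeriv₂, norm_mul, norm_mul, norm_laplaceKernel β h]
  have := Real.rpow_nonneg h.le β.re
  gcongr
  refine (norm_add_le _ _).trans ?_
  rw [norm_mul, norm_pow, norm_one]
  gcongr
  exact norm_laplaceBaseDeriv_div_le h hK

section Continuity

variable {c : ℝ → ℝ} (hc : Continuous c) (h : ∀ s, 0 < laplaceBase (c s) τ)
include hc

theorem continuous_laplaceBase (τ : ℝ) : Continuous fun s => laplaceBase (c s) τ := by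
  unfold laplaceBase; fun_prop

include h

theorem continuous_laplaceKernel (β : ℂ) : Continuous fun s => laplaceKernel β (c s) τ :=
  (Complex.continuous_ofReal.comp (continuous_laplaceBase hc τ)).cpow continuous_const
    fun s => Or.inl (by simpa using h s)

theorem continuous_laplaceBaseDeriv_div :
    Continuous fun s => ((laplaceBaseDeriv (c s) τ / laplaceBase (c s) τ : ℝ) : ℂ) := by
  refine Complex.continuous_ofReal.comp
    (Continuous.div ?_ (continuous_laplaceBase hc τ) fun s => (h s).ne')
  unfold laplaceBaseDeriv; fun_prop

theorem continuous_laplaceKernelDeriv (β : ℂ) :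
    Continuous fun s => laplaceKernelDeriv β (c s) τ :=
  (continuous_const.mul (continuous_laplaceKernel hc h β)).mul
    (continuous_laplaceBaseDeriv_div hc h)

theorem continuous_laplaceKernelDeriv₂ (β : ℂ) :
    Continuous fun s => laplaceKernelDeriv₂ β (c s) τ :=
  (continuous_const.mul (continuous_laplaceKernel hc h β)).mul
    ((continuous_const.mul ((continuous_laplaceBaseDeriv_div hc h).pow 2)).add continuous_const)

end Continuity

-- `κ = -1` covers `c = cos`, `e = -sin` (first kind), `κ = 1` covers `c = cosh`, `e = sinh`
-- (second kind).
theorem hasDerivAt_laplaceKernel_mul_div (β : ℂ) {c e : ℝ → ℝ} {κ s : ℝ}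
    (hc : HasDerivAt c (e s) s) (he : HasDerivAt e (κ * c s) s) (hκ : κ ^ 2 = 1)
    (hce : κ * e s ^ 2 = c s ^ 2 - 1) (hpos : 0 < laplaceBase (c s) τ) (hτ : Real.sinh τ ≠ 0) :
    HasDerivAt (fun x => β * laplaceKernel β (c x) τ * ((κ * e x / laplaceBase (c x) τ : ℝ) : ℂ))
      (Real.sinh τ * legendreDefect β (c s) τ) s := by
  have hbase : HasDerivAt (fun x => laplaceBase (c x) τ) (Real.sinh τ * e s) s :=
    (hc.const_mul (Real.sinh τ)).const_add (Real.cosh τ)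
  have hratio := ((he.const_mul κ).div hbase hpos.ne').ofReal_comp
  refine (((hasDerivAt_ofReal_cpow_const β hbase hpos).const_mul β).mul hratio).congr_deriv ?_
  have hbase_ne : (laplaceBase (c s) τ : ℂ) ≠ 0 := by exact_mod_cast hpos.ne'
  have hsinh_ne : (Real.sinh τ : ℂ) ≠ 0 := by exact_mod_cast hτ
  have hκ' : (κ : ℂ) ^ 2 = 1 := by exact_mod_cast hκ
  have hce' : (κ : ℂ) * (e s : ℂ) ^ 2 = (c s : ℂ) ^ 2 - 1 := by exact_mod_cast hce
  have hcosh : (Real.cosh τ : ℂ) ^ 2 = (Real.sinh τ : ℂ) ^ 2 + 1 := by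
    exact_mod_cast Real.cosh_sq τ
  have hX : (laplaceBase (c s) τ : ℂ) = Real.cosh τ + Real.sinh τ * c s := by
    simp [laplaceBase]
  have hY : (laplaceBaseDeriv (c s) τ : ℂ) = Real.sinh τ + Real.cosh τ * c s := by
    simp [laplaceBaseDeriv]
  have hY_sq : (laplaceBaseDeriv (c s) τ : ℂ) ^ 2 =
      (laplaceBase (c s) τ : ℂ) ^ 2 + ((c s : ℂ) ^ 2 - 1) := by
    rw [hX, hY]; linear_combination ((c s : ℂ) ^ 2 - 1) * hcosh
  have hcosh_mul : (Real.cosh τ : ℂ) * laplaceBaseDeriv (c s) τ =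
      Real.sinh τ * laplaceBase (c s) τ + c s := by
    rw [hX, hY]; linear_combination (c s : ℂ) * hcosh
  unfold legendreDefect laplaceKernelDeriv₂ laplaceKernelDeriv
  change β * (β * laplaceKernel β (c s) τ * _) * _ + β * laplaceKernel β (c s) τ * _ = _
  simp only [Pi.div_apply, Complex.ofReal_div, Complex.ofReal_mul, Complex.ofReal_sub,
    Complex.ofReal_pow]
  field_simp
  linear_combination β * laplaceKernel β (c s) τ * ((β - 1) * Real.sinh τ * hce'
    + laplaceBase (c s) τ * c s * hκ' - Real.sinh τ * (β - 1) * hY_sq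
    - laplaceBase (c s) τ * hcosh_mul)

end LaplaceKernel

section LaplaceIntegral

/-- `∫ (cosh τ + sinh τ · c s) ^ β dμ(s)`: the common form of Laplace's integral for the Legendre
function of the first kind and of Heine's integral for the one of the second kind. -/
def laplaceIntegral (μ : Measure ℝ) (c : ℝ → ℝ) (β : ℂ) (τ : ℝ) : ℂ :=
  ∫ s, laplaceKernel β (c s) τ ∂μ

/-- The `τ`-derivative of `laplaceIntegral`. -/
def laplaceIntegralDeriv (μ : Measure ℝ) (c : ℝ → ℝ) (β : ℂ) (τ : ℝ) : ℂ :=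
  ∫ s, laplaceKernelDeriv β (c s) τ ∂μ

/-- Local domination near `τ₀`, by a function integrable in `s`, of the integrands of
`laplaceIntegral μ c β` and its first two derivatives, for every `β` with real part `r`. -/
structure IsLaplaceDominated (μ : Measure ℝ) (c : ℝ → ℝ) (r τ₀ : ℝ) : Prop where
  continuous : Continuous c
  exists_bound : ∃ (K : ℝ) (g : ℝ → ℝ), Integrable g μ ∧ ∀ᶠ τ in 𝓝 τ₀, ∀ s,
    0 < laplaceBase (c s) τ ∧ |laplaceBaseDeriv (c s) τ| ≤ K * laplaceBase (c s) τ ∧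
      laplaceBase (c s) τ ^ r ≤ g s

namespace IsLaplaceDominated

variable {μ : Measure ℝ} {c : ℝ → ℝ} {β : ℂ} {τ₀ : ℝ}

theorem integrable_laplaceKernel (H : IsLaplaceDominated μ c β.re τ₀) :
    Integrable (fun s => laplaceKernel β (c s) τ₀) μ := by
  obtain ⟨K, g, hg, hbound⟩ := H.exists_bound
  have hτ₀ := hbound.self_of_nhds
  refine hg.mono'
    (continuous_laplaceKernel H.continuous (fun s => (hτ₀ s).1) β).aestronglyMeasurable
    (ae_of_all _ fun s => ?_)
  rw [norm_laplaceKernel β (hτ₀ s).1]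
  exact (hτ₀ s).2.2

theorem integrable_and_hasDerivAt_laplaceIntegral (H : IsLaplaceDominated μ c β.re τ₀) :
    Integrable (fun s => laplaceKernelDeriv β (c s) τ₀) μ ∧
      HasDerivAt (laplaceIntegral μ c β) (laplaceIntegralDeriv μ c β τ₀) τ₀ := by
  obtain ⟨K, g, hg, hbound⟩ := H.exists_bound
  have hτ₀ := hbound.self_of_nhds
  have hK : 0 ≤ K :=
    nonneg_of_mul_nonneg_left ((abs_nonneg _).trans (hτ₀ 0).2.1) (hτ₀ 0).1
  refine hasDerivAt_integral_of_dominated_loc_of_deriv_le (F := fun τ s => laplaceKernel β (c s) τ)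
    (F' := fun τ s => laplaceKernelDeriv β (c s) τ) (bound := fun s => ‖β‖ * g s * K) hbound ?_
    H.integrable_laplaceKernel ?_ (ae_of_all _ fun s τ hτ => ?_)
    ((hg.const_mul _).mul_const _)
    (ae_of_all _ fun s τ hτ => hasDerivAt_laplaceKernel β (hτ s).1)
  · filter_upwards [hbound] with τ hτ
    exact (continuous_laplaceKernel H.continuous (fun s => (hτ s).1) β).aestronglyMeasurable
  · exact (continuous_laplaceKernelDeriv H.continuous (fun s => (hτ₀ s).1) β).aestronglyMeasurable
  · refine (norm_laplaceKernelDeriv_le β (hτ s).1 (hτ s).2.1).trans ?_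
    gcongr
    exact (hτ s).2.2

theorem integrable_and_hasDerivAt_laplaceIntegralDeriv (H : IsLaplaceDominated μ c β.re τ₀) :
    Integrable (fun s => laplaceKernelDeriv₂ β (c s) τ₀) μ ∧
      HasDerivAt (laplaceIntegralDeriv μ c β) (∫ s, laplaceKernelDeriv₂ β (c s) τ₀ ∂μ) τ₀ := by
  obtain ⟨K, g, hg, hbound⟩ := H.exists_bound
  have hτ₀ := hbound.self_of_nhds
  refine hasDerivAt_integral_of_dominated_loc_of_deriv_le
    (F := fun τ s => laplaceKernelDeriv β (c s) τ) (F' := fun τ s => laplaceKernelDeriv₂ β (c s) τ)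
    (bound := fun s => ‖β‖ * g s * (‖β - 1‖ * K ^ 2 + 1)) hbound ?_
    H.integrable_and_hasDerivAt_laplaceIntegral.1 ?_ (ae_of_all _ fun s τ hτ => ?_)
    ((hg.const_mul _).mul_const _)
    (ae_of_all _ fun s τ hτ => hasDerivAt_laplaceKernelDeriv β (hτ s).1)
  · filter_upwards [hbound] with τ hτ
    exact (continuous_laplaceKernelDeriv H.continuous (fun s => (hτ s).1) β).aestronglyMeasurable
  · exact (continuous_laplaceKernelDeriv₂ H.continuous (fun s => (hτ₀ s).1) β).aestronglyMeasurable
  · refine (norm_laplaceKernelDeriv₂_le β (hτ s).1 (hτ s).2.1).trans ?_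
    gcongr
    exact (hτ s).2.2

theorem hasDerivAt_laplaceIntegral (H : IsLaplaceDominated μ c β.re τ₀) :
    HasDerivAt (laplaceIntegral μ c β) (laplaceIntegralDeriv μ c β τ₀) τ₀ :=
  H.integrable_and_hasDerivAt_laplaceIntegral.2

theorem continuousAt_laplaceIntegralDeriv (H : IsLaplaceDominated μ c β.re τ₀) :
    ContinuousAt (laplaceIntegralDeriv μ c β) τ₀ :=
  H.integrable_and_hasDerivAt_laplaceIntegralDeriv.2.continuousAt

theorem integrable_legendreDefect (H : IsLaplaceDominated μ c β.re τ₀) :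
    Integrable (fun s => legendreDefect β (c s) τ₀) μ :=
  (H.integrable_and_hasDerivAt_laplaceIntegralDeriv.1.add
    (H.integrable_and_hasDerivAt_laplaceIntegral.1.const_mul _)).sub
    (H.integrable_laplaceKernel.const_mul _)

theorem integral_legendreDefect (H : IsLaplaceDominated μ c β.re τ₀) :
    ∫ s, legendreDefect β (c s) τ₀ ∂μ = ∫ s, laplaceKernelDeriv₂ β (c s) τ₀ ∂μ
      + ((Real.cosh τ₀ / Real.sinh τ₀ : ℝ) : ℂ) * laplaceIntegralDeriv μ c β τ₀
      - β * (β + 1) * laplaceIntegral μ c β τ₀ := by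
  have hderiv := H.integrable_and_hasDerivAt_laplaceIntegral.1.const_mul
    ((Real.cosh τ₀ / Real.sinh τ₀ : ℝ) : ℂ)
  have hderiv₂ := H.integrable_and_hasDerivAt_laplaceIntegralDeriv.1
  have hsum : Integrable (fun s => laplaceKernelDeriv₂ β (c s) τ₀ +
      ((Real.cosh τ₀ / Real.sinh τ₀ : ℝ) : ℂ) * laplaceKernelDeriv β (c s) τ₀) μ :=
    hderiv₂.add hderiv
  simp only [legendreDefect, laplaceIntegral, laplaceIntegralDeriv]
  rw [integral_sub hsum (H.integrable_laplaceKernel.const_mul _),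
    integral_add hderiv₂ hderiv, integral_const_mul, integral_const_mul]

end IsLaplaceDominated

theorem isRadialSolutionOn_laplaceIntegral {μ : Measure ℝ} {c : ℝ → ℝ} {β : ℂ}
    (H : ∀ τ, 0 < τ → IsLaplaceDominated μ c β.re τ)
    (hdefect : ∀ τ, 0 < τ → ∫ s, Real.sinh τ * legendreDefect β (c s) τ ∂μ = 0) :
    IsRadialSolutionOn univ (β * (β + 1)) 0 (laplaceIntegral μ c β)
      (laplaceIntegralDeriv μ c β) := by
  refine fun τ _ hτ => ⟨(H τ hτ).hasDerivAt_laplaceIntegral.hasDerivWithinAt, ?_⟩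
  refine ((H τ hτ).integrable_and_hasDerivAt_laplaceIntegralDeriv.2.congr_deriv ?_).hasDerivWithinAt
  have hsinh : (Real.sinh τ : ℂ) ≠ 0 := by exact_mod_cast (Real.sinh_pos_iff.2 hτ).ne'
  have hzero := hdefect τ hτ
  rw [integral_const_mul, mul_eq_zero, or_iff_right hsinh, (H τ hτ).integral_legendreDefect]
    at hzero
  rw [Complex.real_smul, Pi.zero_apply]
  linear_combination hzero

end LaplaceIntegral

section LegendreFunctions

theorem sqrt_cosh_sq_sub_one {τ : ℝ} (h : 0 ≤ τ) :
    Real.sqrt (Real.cosh τ ^ 2 - 1) = Real.sinh τ := by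
  rw [Real.cosh_sq, add_sub_cancel_right, Real.sqrt_sq (Real.sinh_nonneg_iff.2 h)]

theorem sqrt_mul_deriv_cosh {f F : ℝ → ℂ} (hf : ∀ τ, 0 < τ → f (Real.cosh τ) = F τ) {τ : ℝ}
    {F' : ℂ} (hτ : 0 < τ) (hF : HasDerivAt F F' τ) :
    (Real.sqrt (Real.cosh τ ^ 2 - 1) : ℂ) * deriv f (Real.cosh τ) = F' := by
  have hcosh : 1 < Real.cosh τ := Real.one_lt_cosh.2 hτ.ne'
  have harcosh := Real.hasDerivAt_arcosh (x := Real.cosh τ) hcosh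
  rw [sqrt_cosh_sq_sub_one hτ.le] at harcosh ⊢
  rw [← Real.arcosh_cosh hτ.le] at hF
  have heq : f =ᶠ[𝓝 (Real.cosh τ)] F ∘ Real.arcosh := by
    filter_upwards [lt_mem_nhds hcosh] with z hz
    rw [Function.comp, ← hf _ (Real.arcosh_pos hz), Real.cosh_arcosh hz.le]
  rw [((hF.scomp (Real.cosh τ) harcosh).congr_of_eventuallyEq heq).deriv]
  have hsinh : (Real.sinh τ : ℂ) ≠ 0 := by exact_mod_cast (Real.sinh_pos_iff.2 hτ).ne'
  rw [Complex.real_smul, Complex.ofReal_inv, mul_inv_cancel_left₀ hsinh]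

section FirstKind

theorem exp_neg_abs_le_laplaceBase_cos (θ τ : ℝ) :
    Real.exp (-|τ|) ≤ laplaceBase (Real.cos θ) τ := by
  have hexp : Real.exp (-|τ|) = Real.cosh τ - |Real.sinh τ| := by
    rw [← Real.cosh_abs, Real.abs_sinh, Real.cosh_sub_sinh]
  have hcos := mul_le_of_le_one_right (abs_nonneg (Real.sinh τ)) (Real.abs_cos_le_one θ)
  rw [← abs_mul] at hcos
  rw [hexp, laplaceBase]
  linarith [neg_abs_le (Real.sinh τ * Real.cos θ)]

theorem laplaceBase_cos_le_exp_abs (θ τ : ℝ) :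
    laplaceBase (Real.cos θ) τ ≤ Real.exp |τ| := by
  have hexp : Real.exp |τ| = Real.cosh τ + |Real.sinh τ| := by
    rw [← Real.cosh_abs, Real.abs_sinh, Real.cosh_add_sinh]
  have hcos := mul_le_of_le_one_right (abs_nonneg (Real.sinh τ)) (Real.abs_cos_le_one θ)
  rw [← abs_mul] at hcos
  rw [hexp, laplaceBase]
  linarith [le_abs_self (Real.sinh τ * Real.cos θ)]

theorem laplaceBase_cos_pos (θ τ : ℝ) : 0 < laplaceBase (Real.cos θ) τ :=
  (Real.exp_pos _).trans_le (exp_neg_abs_le_laplaceBase_cos θ τ)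

theorem laplaceBase_cos_rpow_le (r θ τ : ℝ) :
    laplaceBase (Real.cos θ) τ ^ r ≤ Real.exp (|r| * |τ|) := by
  have hpos := laplaceBase_cos_pos θ τ
  rw [Real.rpow_def_of_pos hpos, Real.exp_le_exp, mul_comm |r|]
  refine (le_abs_self _).trans ?_
  rw [abs_mul]
  refine mul_le_mul_of_nonneg_right (abs_le.2 ⟨?_, ?_⟩) (abs_nonneg r)
  · exact (Real.le_log_iff_exp_le hpos).2 (exp_neg_abs_le_laplaceBase_cos θ τ)
  · exact (Real.log_le_iff_le_exp hpos).2 (laplaceBase_cos_le_exp_abs θ τ)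

theorem abs_laplaceBaseDeriv_cos_le (θ τ : ℝ) :
    |laplaceBaseDeriv (Real.cos θ) τ| ≤ laplaceBase (Real.cos θ) τ := by
  have hplus := Real.exp_pos τ
  have hminus := Real.exp_pos (-τ)
  rw [← Real.cosh_add_sinh] at hplus
  rw [← Real.cosh_sub_sinh] at hminus
  have hcos_ge := Real.neg_one_le_cos θ
  have hcos_le := Real.cos_le_one θ
  rw [abs_le, laplaceBase, laplaceBaseDeriv]
  constructor <;> nlinarith

theorem isLaplaceDominated_cos (r τ₀ : ℝ) :
    IsLaplaceDominated (volume.restrict (Ioc 0 Real.pi)) Real.cos r τ₀ where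
  continuous := Real.continuous_cos
  exists_bound := by
    refine ⟨1, fun _ => Real.exp (|r| * (|τ₀| + 1)), integrable_const _, ?_⟩
    have hnear : ∀ᶠ τ in 𝓝 τ₀, |τ| < |τ₀| + 1 :=
      continuous_abs.continuousAt.eventually_lt_const (lt_add_one _)
    filter_upwards [hnear] with τ hτ θ
    refine ⟨laplaceBase_cos_pos θ τ, by simpa using abs_laplaceBaseDeriv_cos_le θ τ,
      (laplaceBase_cos_rpow_le r θ τ).trans ?_⟩
    gcongr

theorem integral_legendreDefect_cos (α : ℂ) {τ : ℝ} (hτ : 0 < τ) :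
    ∫ θ in Ioc 0 Real.pi, Real.sinh τ * legendreDefect α (Real.cos θ) τ = 0 := by
  have hint : IntervalIntegrable (fun θ => Real.sinh τ * legendreDefect α (Real.cos θ) τ)
      volume 0 Real.pi :=
    (intervalIntegrable_iff_integrableOn_Ioc_of_le Real.pi_pos.le).2
      ((isLaplaceDominated_cos α.re τ).integrable_legendreDefect.const_mul _)
  rw [← intervalIntegral.integral_of_le Real.pi_pos.le,
    intervalIntegral.integral_eq_sub_of_hasDerivAt (fun θ _ => hasDerivAt_laplaceKernel_mul_div
      (e := fun x => -Real.sin x) (κ := -1) α (Real.hasDerivAt_cos θ) ?_ (by norm_num) ?_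
      (laplaceBase_cos_pos θ τ) (Real.sinh_pos_iff.2 hτ).ne') hint]
  · simp
  · exact (Real.hasDerivAt_sin θ).neg.congr_deriv (by ring)
  · linarith [Real.sin_sq_add_cos_sq θ, neg_sq (Real.sin θ)]

theorem legendreP_cosh (α : ℂ) {τ : ℝ} (h : 0 ≤ τ) : legendreP α (Real.cosh τ) =
    (1 / Real.pi : ℂ) * laplaceIntegral (volume.restrict (Ioc 0 Real.pi)) Real.cos α τ := by
  rw [legendreP, sqrt_cosh_sq_sub_one h, intervalIntegral.integral_of_le Real.pi_pos.le]
  rfl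

theorem laplaceIntegralDeriv_cos_zero (α : ℂ) :
    laplaceIntegralDeriv (volume.restrict (Ioc 0 Real.pi)) Real.cos α 0 = 0 := by
  have hkernel θ : laplaceKernelDeriv α (Real.cos θ) 0 = α * ((Real.cos θ : ℝ) : ℂ) := by
    simp [laplaceKernelDeriv, laplaceKernel, laplaceBase, laplaceBaseDeriv]
  simp only [laplaceIntegralDeriv, hkernel]
  rw [integral_const_mul, integral_complex_ofReal,
    ← intervalIntegral.integral_of_le Real.pi_pos.le]
  simp

theorem legendreP1_cosh (α : ℂ) {τ : ℝ} (h : 0 ≤ τ) : legendreP1 α (Real.cosh τ) =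
    (1 / Real.pi : ℂ) * laplaceIntegralDeriv (volume.restrict (Ioc 0 Real.pi)) Real.cos α τ := by
  rcases h.eq_or_lt with rfl | hpos
  · simp [legendreP1, laplaceIntegralDeriv_cos_zero]
  · rw [legendreP1, sqrt_mul_deriv_cosh (fun t ht => legendreP_cosh α ht.le) hpos
      ((isLaplaceDominated_cos α.re τ).hasDerivAt_laplaceIntegral.const_mul _)]

theorem isRadialSolutionOn_legendreP (α : ℂ) :
    IsRadialSolutionOn univ (α * (α + 1)) 0 (fun τ => legendreP α (Real.cosh τ))
      fun τ => legendreP1 α (Real.cosh τ) := by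
  have h := ((isRadialSolutionOn_laplaceIntegral (fun τ _ => isLaplaceDominated_cos α.re τ)
    fun _ hτ => integral_legendreDefect_cos α hτ).const_mul (1 / Real.pi)).congr
    (fun _ _ hτ => legendreP_cosh α hτ.le) fun _ _ hτ => legendreP1_cosh α hτ.le
  simpa only [Pi.zero_def, mul_zero] using h

theorem continuousOn_legendreP_cosh (α : ℂ) :
    ContinuousOn (fun τ => legendreP α (Real.cosh τ)) (Ici 0) :=
  ContinuousOn.congr (fun τ _ => ((isLaplaceDominated_cos α.re
    τ).hasDerivAt_laplaceIntegral.continuousAt.const_mul _).continuousWithinAt)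
    fun _ hτ => legendreP_cosh α hτ

theorem continuousOn_legendreP1_cosh (α : ℂ) :
    ContinuousOn (fun τ => legendreP1 α (Real.cosh τ)) (Ici 0) :=
  ContinuousOn.congr (fun τ _ => ((isLaplaceDominated_cos α.re
    τ).continuousAt_laplaceIntegralDeriv.const_mul _).continuousWithinAt)
    fun _ hτ => legendreP1_cosh α hτ

theorem legendreP_one (α : ℂ) : legendreP α 1 = 1 := by
  have hpi : (Real.pi : ℂ) ≠ 0 := by exact_mod_cast Real.pi_ne_zero
  simp [legendreP, hpi]

end FirstKind

section SecondKind

variable {β : ℂ} {τ : ℝ}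

theorem sinh_div_two_mul_exp_le_laplaceBase_cosh (hτ : 0 < τ) (s : ℝ) :
    Real.sinh τ / 2 * Real.exp s ≤ laplaceBase (Real.cosh s) τ := by
  have hsinh := Real.sinh_pos_iff.2 hτ
  have hexp : Real.exp s ≤ 2 * Real.cosh s := by
    rw [Real.cosh_eq]; linarith [Real.exp_pos (-s)]
  rw [laplaceBase]
  nlinarith [Real.cosh_pos τ]

theorem one_le_laplaceBase_cosh (hτ : 0 ≤ τ) (s : ℝ) : 1 ≤ laplaceBase (Real.cosh s) τ :=
  le_add_of_le_of_nonneg (Real.one_le_cosh τ)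
    (mul_nonneg (Real.sinh_nonneg_iff.2 hτ) (Real.cosh_pos s).le)

theorem laplaceBase_cosh_pos (hτ : 0 ≤ τ) (s : ℝ) : 0 < laplaceBase (Real.cosh s) τ :=
  one_pos.trans_le (one_le_laplaceBase_cosh hτ s)

theorem abs_laplaceBaseDeriv_cosh_le (hτ : 0 < τ) (s : ℝ) :
    |laplaceBaseDeriv (Real.cosh s) τ| ≤
      Real.cosh τ / Real.sinh τ * laplaceBase (Real.cosh s) τ := by
  have hsinh := Real.sinh_pos_iff.2 hτ
  have hderiv : 0 ≤ laplaceBaseDeriv (Real.cosh s) τ := by rw [laplaceBaseDeriv]; positivity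
  rw [abs_of_nonneg hderiv, div_mul_eq_mul_div, le_div_iff₀ hsinh,
    laplaceBase, laplaceBaseDeriv]
  nlinarith [Real.cosh_sq τ, Real.cosh_pos s]

theorem abs_sinh_div_laplaceBase_cosh_le (hτ : 0 < τ) (s : ℝ) :
    |Real.sinh s / laplaceBase (Real.cosh s) τ| ≤ 1 / Real.sinh τ := by
  have hsinh := Real.sinh_pos_iff.2 hτ
  have hpos := laplaceBase_cosh_pos hτ.le s
  have habs : |Real.sinh s| ≤ Real.cosh s := by
    rw [Real.abs_sinh, ← Real.cosh_abs]; exact (Real.sinh_lt_cosh _).le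
  rw [abs_div, abs_of_pos hpos, div_le_div_iff₀ hpos hsinh, laplaceBase]
  nlinarith [Real.cosh_pos τ]

theorem laplaceBase_cosh_rpow_le {σ r : ℝ} (hr : r ≤ 0) (hσ : 0 < σ) (hτ : σ ≤ τ) (s : ℝ) :
    laplaceBase (Real.cosh s) τ ^ r ≤ (Real.sinh σ / 2) ^ r * Real.exp (r * s) := by
  have := Real.sinh_pos_iff.2 hσ
  have hbase : Real.sinh σ / 2 * Real.exp s ≤ laplaceBase (Real.cosh s) τ := by
    refine le_trans ?_ (sinh_div_two_mul_exp_le_laplaceBase_cosh (hσ.trans_le hτ) s)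
    have := Real.sinh_le_sinh.2 hτ
    gcongr
  refine (Real.rpow_le_rpow_of_nonpos (by positivity) hbase hr).trans_eq ?_
  rw [Real.mul_rpow (by positivity) (Real.exp_pos _).le, ← Real.exp_mul, mul_comm s]

theorem isLaplaceDominated_cosh {r τ₀ : ℝ} (hr : r < 0) (h : 0 < τ₀) :
    IsLaplaceDominated (volume.restrict (Ioi 0)) Real.cosh r τ₀ where
  continuous := Real.continuous_cosh
  exists_bound := by
    refine ⟨Real.cosh (2 * τ₀) / Real.sinh (τ₀ / 2),
      fun s => (Real.sinh (τ₀ / 2) / 2) ^ r * Real.exp (r * s),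
      (integrableOn_exp_mul_Ioi hr 0).const_mul _, ?_⟩
    filter_upwards [Ioo_mem_nhds (show τ₀ / 2 < τ₀ by linarith) (show τ₀ < 2 * τ₀ by linarith)]
      with τ hτ s
    have hpos : 0 < τ := by linarith [hτ.1]
    have hbase := laplaceBase_cosh_pos hpos.le s
    refine ⟨hbase, (abs_laplaceBaseDeriv_cosh_le hpos s).trans ?_,
      laplaceBase_cosh_rpow_le hr.le (by linarith) hτ.1.le s⟩
    have : 0 < Real.sinh (τ₀ / 2) := Real.sinh_pos_iff.2 (by linarith)
    have hsinh_le : Real.sinh (τ₀ / 2) ≤ Real.sinh τ := Real.sinh_le_sinh.2 hτ.1.le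
    have hcosh_le : Real.cosh τ ≤ Real.cosh (2 * τ₀) :=
      Real.cosh_le_cosh.2 (by rw [abs_of_pos hpos, abs_of_pos (by linarith)]; exact hτ.2.le)
    gcongr

theorem tendsto_laplaceKernel_cosh_atTop (hβ : β.re < 0) (hτ : 0 < τ) :
    Tendsto (fun s => laplaceKernel β (Real.cosh s) τ) atTop (𝓝 0) := by
  have hexp : Tendsto (fun s => (Real.sinh τ / 2) ^ β.re * Real.exp (β.re * s)) atTop (𝓝 0) := by
    simpa using (Real.tendsto_exp_atBot.comp
      (tendsto_id.const_mul_atTop_of_neg hβ)).const_mul ((Real.sinh τ / 2) ^ β.re)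
  refine squeeze_zero_norm (fun s => ?_) hexp
  rw [norm_laplaceKernel _ (laplaceBase_cosh_pos hτ.le s)]
  exact laplaceBase_cosh_rpow_le hβ.le hτ le_rfl s

theorem integral_legendreDefect_cosh (hβ : β.re < 0) (hτ : 0 < τ) :
    ∫ s in Ioi (0 : ℝ), Real.sinh τ * legendreDefect β (Real.cosh s) τ = 0 := by
  rw [integral_Ioi_of_hasDerivAt_of_tendsto' (m := 0)
    (fun s _ => hasDerivAt_laplaceKernel_mul_div (e := Real.sinh) (κ := 1) β
      (Real.hasDerivAt_cosh s) (by simpa using Real.hasDerivAt_sinh s) (by norm_num)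
      (by rw [Real.cosh_sq]; ring) (laplaceBase_cosh_pos hτ.le s) (Real.sinh_pos_iff.2 hτ).ne')
    ((isLaplaceDominated_cosh hβ hτ).integrable_legendreDefect.const_mul _) ?_]
  · simp
  · simp only [one_mul]
    refine Tendsto.zero_mul_isBoundedUnder_le
      (by simpa using (tendsto_laplaceKernel_cosh_atTop hβ hτ).const_mul β)
      (isBoundedUnder_of ⟨1 / Real.sinh τ, fun s => ?_⟩)
    rw [Function.comp, Complex.norm_real]
    exact abs_sinh_div_laplaceBase_cosh_le hτ s

theorem legendreQ_cosh (α : ℂ) (h : 0 ≤ τ) : legendreQ α (Real.cosh τ) =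
    laplaceIntegral (volume.restrict (Ioi 0)) Real.cosh (-α - 1) τ := by
  rw [legendreQ, sqrt_cosh_sq_sub_one h]
  rfl

theorem re_neg_sub_one_neg {α : ℂ} (hα : -1 < α.re) : (-α - 1).re < 0 := by
  rw [Complex.sub_re, Complex.neg_re, Complex.one_re]
  linarith

theorem legendreQ1_cosh {α : ℂ} (hα : -1 < α.re) (hτ : 0 < τ) : legendreQ1 α (Real.cosh τ) =
    laplaceIntegralDeriv (volume.restrict (Ioi 0)) Real.cosh (-α - 1) τ := by
  rw [legendreQ1, sqrt_mul_deriv_cosh (fun t ht => legendreQ_cosh α ht.le) hτ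
    (isLaplaceDominated_cosh (re_neg_sub_one_neg hα) hτ).hasDerivAt_laplaceIntegral]

theorem isRadialSolutionOn_legendreQ {α : ℂ} (hα : -1 < α.re) :
    IsRadialSolutionOn univ (α * (α + 1)) 0 (fun τ => legendreQ α (Real.cosh τ))
      fun τ => legendreQ1 α (Real.cosh τ) := by
  have hβ := re_neg_sub_one_neg hα
  have heq : α * (α + 1) = (-α - 1) * (-α - 1 + 1) := by ring
  rw [heq]
  exact (isRadialSolutionOn_laplaceIntegral (fun τ hτ => isLaplaceDominated_cosh hβ hτ)
    fun τ hτ => integral_legendreDefect_cosh hβ hτ).congr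
    (fun _ _ hτ => legendreQ_cosh α hτ.le) fun _ _ hτ => legendreQ1_cosh hα hτ

end SecondKind

end LegendreFunctions

section SecondKindAtZero

variable {β : ℂ} {ε τ : ℝ}

theorem norm_laplaceKernel_cosh_le (hε : 0 < ε) (hβ : ε ≤ -β.re) (hτ : 0 < τ) (s : ℝ) :
    ‖laplaceKernel β (Real.cosh s) τ‖ ≤ (Real.sinh τ / 2) ^ (-ε) * Real.exp (-ε * s) := by
  rw [norm_laplaceKernel β (laplaceBase_cosh_pos hτ.le s)]
  exact (Real.rpow_le_rpow_of_exponent_le (one_le_laplaceBase_cosh hτ.le s)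
    (le_neg_of_le_neg hβ)).trans (laplaceBase_cosh_rpow_le (neg_nonpos.2 hε.le) hτ le_rfl s)

theorem norm_integral_laplaceKernel_cosh_mul_le (hε : 0 < ε) (hβ : ε ≤ -β.re) (hτ : 0 < τ)
    {W : ℝ → ℂ} {M : ℝ} (hW : ∀ s, 0 < s → ‖W s‖ ≤ M) :
    ‖∫ s in Ioi (0 : ℝ), laplaceKernel β (Real.cosh s) τ * W s‖ ≤
      M * ((Real.sinh τ / 2) ^ (-ε) / ε) := by
  have hε' : -ε < 0 := neg_lt_zero.2 hε
  have hexp : ∫ s in Ioi (0 : ℝ), Real.exp (-ε * s) = 1 / ε := by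
    rw [integral_exp_mul_Ioi hε']; simp
  calc ‖∫ s in Ioi (0 : ℝ), laplaceKernel β (Real.cosh s) τ * W s‖
      ≤ ∫ s in Ioi (0 : ℝ), (Real.sinh τ / 2) ^ (-ε) * Real.exp (-ε * s) * M := by
        refine norm_integral_le_of_norm_le
          (((integrableOn_exp_mul_Ioi hε' 0).const_mul _).mul_const _)
          ((ae_restrict_iff' measurableSet_Ioi).2 (ae_of_all _ fun s hs => ?_))
        have := Real.sinh_pos_iff.2 hτ
        rw [norm_mul]
        gcongr
        · exact norm_laplaceKernel_cosh_le hε hβ hτ s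
        · exact hW s hs
    _ = M * ((Real.sinh τ / 2) ^ (-ε) / ε) := by
        rw [integral_mul_const, integral_const_mul, hexp]; ring

theorem tendsto_sinh_mul_rpow_neg (hε : ε < 1) :
    Tendsto (fun τ => Real.sinh τ * ((Real.sinh τ / 2) ^ (-ε) / ε)) (𝓝[>] 0) (𝓝 0) := by
  have hcont : ContinuousAt (fun τ => 2 / ε * (Real.sinh τ / 2) ^ (1 - ε)) 0 :=
    continuousAt_const.mul ((Real.continuous_sinh.div_const 2).continuousAt.rpow_const
      (Or.inr (sub_nonneg.2 hε.le)))
  have hlim := hcont.tendsto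
  simp only [Real.sinh_zero, zero_div, Real.zero_rpow (sub_pos.2 hε).ne', mul_zero] at hlim
  refine (hlim.mono_left nhdsWithin_le_nhds).congr' ?_
  filter_upwards [self_mem_nhdsWithin] with τ hτ
  have hpos : 0 < Real.sinh τ / 2 := half_pos (Real.sinh_pos_iff.2 hτ)
  rw [sub_eq_add_neg, Real.rpow_add hpos, Real.rpow_one]
  ring

theorem integrableOn_and_integral_laplaceKernel_angle_deriv (hβ : β.re < 0) (hτ : 0 < τ) :
    IntegrableOn (fun s => β * laplaceKernel β (Real.cosh s) τ *
      ((Real.sinh τ * Real.sinh s / laplaceBase (Real.cosh s) τ : ℝ) : ℂ)) (Ioi 0) ∧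
    ∫ s in Ioi (0 : ℝ), β * laplaceKernel β (Real.cosh s) τ *
      ((Real.sinh τ * Real.sinh s / laplaceBase (Real.cosh s) τ : ℝ) : ℂ) =
      -laplaceKernel β 1 τ := by
  have hsinh := Real.sinh_pos_iff.2 hτ
  have hpos := laplaceBase_cosh_pos hτ.le
  have hint : IntegrableOn (fun s => β * laplaceKernel β (Real.cosh s) τ *
      ((Real.sinh τ * Real.sinh s / laplaceBase (Real.cosh s) τ : ℝ) : ℂ)) (Ioi 0) := by
    refine ((isLaplaceDominated_cosh hβ hτ).integrable_laplaceKernel.const_mul β).mul_bdd (c := 1)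
      (Complex.continuous_ofReal.comp ((by fun_prop : Continuous fun s =>
        Real.sinh τ * Real.sinh s).div (continuous_laplaceBase Real.continuous_cosh τ)
          fun s => (hpos s).ne')).aestronglyMeasurable (ae_of_all _ fun s => ?_)
    have hbound := abs_sinh_div_laplaceBase_cosh_le hτ s
    rw [Complex.norm_real, Real.norm_eq_abs, mul_div_assoc, abs_mul, abs_of_pos hsinh]
    rwa [le_div_iff₀' hsinh] at hbound
  refine ⟨hint, ?_⟩
  refine (integral_Ioi_of_hasDerivAt_of_tendsto' (f := fun s => laplaceKernel β (Real.cosh s) τ)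
    (fun s _ => hasDerivAt_ofReal_cpow_const β
      (((Real.hasDerivAt_cosh s).const_mul (Real.sinh τ)).const_add (Real.cosh τ)) (hpos s)) hint
    (tendsto_laplaceKernel_cosh_atTop hβ hτ)).trans ?_
  rw [Real.cosh_zero, zero_sub]

-- `exp (-s)` stands for `cosh s - sinh s`: the leading, non-integrable part of `sinh τ` times the
-- derivative kernel is the derivative of the kernel in the angle `s`.
theorem abs_laplaceKernel_remainder_le (hτ : 0 < τ) {s : ℝ} (hs : 0 < s) :
    |Real.sinh τ * (Real.sinh τ + (Real.cosh τ - 1) * Real.cosh s + Real.exp (-s)) /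
      laplaceBase (Real.cosh s) τ| ≤ Real.sinh τ * (2 * Real.sinh τ + 1) := by
  have hsinh := Real.sinh_pos_iff.2 hτ
  have hcosh_sub : 0 ≤ Real.cosh τ - 1 := sub_nonneg.2 (Real.one_le_cosh τ)
  have hbase := one_le_laplaceBase_cosh hτ.le s
  have := Real.cosh_pos s
  have hexp : Real.exp (-s) ≤ 1 := Real.exp_le_one_iff.2 (by linarith)
  have hsinh_mul_le : Real.sinh τ * Real.cosh s ≤ laplaceBase (Real.cosh s) τ := by
    rw [laplaceBase]; linarith
  have hcosh_sub_le : (Real.cosh τ - 1) * Real.cosh s ≤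
      Real.sinh τ * laplaceBase (Real.cosh s) τ := by
    have hcosh_sub_sq : Real.cosh τ - 1 ≤ Real.sinh τ ^ 2 := by nlinarith [Real.cosh_sq τ]
    calc (Real.cosh τ - 1) * Real.cosh s ≤ Real.sinh τ ^ 2 * Real.cosh s := by gcongr
      _ = Real.sinh τ * (Real.sinh τ * Real.cosh s) := by ring
      _ ≤ _ := by gcongr
  have hnum : Real.sinh τ + (Real.cosh τ - 1) * Real.cosh s + Real.exp (-s) ≤
      (2 * Real.sinh τ + 1) * laplaceBase (Real.cosh s) τ := by
    nlinarith
  rw [abs_of_nonneg (by positivity), div_le_iff₀ (by linarith), mul_assoc]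
  gcongr

theorem norm_sinh_mul_laplaceIntegralDeriv_cosh_add_le (hε : 0 < ε) (hβ : ε ≤ -β.re)
    (hτ : 0 < τ) :
    ‖Real.sinh τ * laplaceIntegralDeriv (volume.restrict (Ioi 0)) Real.cosh β τ
        + laplaceKernel β 1 τ‖ ≤
      ‖β‖ * (2 * Real.sinh τ + 1) * (Real.sinh τ * ((Real.sinh τ / 2) ^ (-ε) / ε)) := by
  have hre : β.re < 0 := by linarith
  obtain ⟨hint, hangle⟩ := integrableOn_and_integral_laplaceKernel_angle_deriv hre hτ
  have hderiv := (isLaplaceDominated_cosh hre hτ).integrable_and_hasDerivAt_laplaceIntegral.1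
  have hsplit : Real.sinh τ * laplaceIntegralDeriv (volume.restrict (Ioi 0)) Real.cosh β τ
        + laplaceKernel β 1 τ =
      β * ∫ s in Ioi (0 : ℝ), laplaceKernel β (Real.cosh s) τ *
        ((Real.sinh τ * (Real.sinh τ + (Real.cosh τ - 1) * Real.cosh s + Real.exp (-s)) /
          laplaceBase (Real.cosh s) τ : ℝ) : ℂ) := by
    rw [← neg_neg (laplaceKernel β 1 τ), ← hangle, laplaceIntegralDeriv, ← integral_const_mul,
      ← sub_eq_add_neg, ← integral_sub (hderiv.const_mul _) hint, ← integral_const_mul]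
    refine integral_congr_ae (ae_of_all _ fun s => ?_)
    simp only [laplaceKernelDeriv, laplaceBaseDeriv, ← Real.cosh_sub_sinh]
    push_cast
    ring
  rw [hsplit, norm_mul, mul_assoc]
  gcongr
  refine (norm_integral_laplaceKernel_cosh_mul_le (M := Real.sinh τ * (2 * Real.sinh τ + 1))
    hε hβ hτ (fun s hs => ?_)).trans_eq ?_
  · rw [Complex.norm_real]
    exact abs_laplaceKernel_remainder_le hτ hs
  · ring

theorem exists_pos_le_neg_re_lt_one (hβ : β.re < 0) : ∃ ε : ℝ, 0 < ε ∧ ε ≤ -β.re ∧ ε < 1 :=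
  ⟨min (-β.re) (1 / 2), lt_min (neg_pos.2 hβ) one_half_pos, min_le_left _ _,
    (min_le_right _ _).trans_lt one_half_lt_one⟩

theorem tendsto_sinh_mul_legendreQ {α : ℂ} (hα : -1 < α.re) :
    Tendsto (fun τ => Real.sinh τ * legendreQ α (Real.cosh τ)) (𝓝[>] 0) (𝓝 0) := by
  obtain ⟨ε, hε, hεα, hε1⟩ := exists_pos_le_neg_re_lt_one (re_neg_sub_one_neg hα)
  refine squeeze_zero_norm' ?_ (tendsto_sinh_mul_rpow_neg hε1)
  filter_upwards [self_mem_nhdsWithin] with τ (hτ : 0 < τ)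
  have hsinh := Real.sinh_pos_iff.2 hτ
  have hbound := norm_integral_laplaceKernel_cosh_mul_le hε hεα hτ
    (W := fun _ => 1) (M := 1) (by simp)
  simp only [mul_one, one_mul] at hbound
  rw [legendreQ_cosh α hτ.le, norm_mul, Complex.norm_real, Real.norm_of_nonneg hsinh.le]
  exact mul_le_mul_of_nonneg_left hbound hsinh.le

theorem tendsto_laplaceKernel_one (β : ℂ) :
    Tendsto (laplaceKernel β 1) (𝓝[>] 0) (𝓝 1) := by
  have hcont : ContinuousAt (laplaceKernel β 1) 0 :=
    (hasDerivAt_laplaceKernel β (by simp [laplaceBase])).continuousAt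
  simpa [laplaceKernel, laplaceBase] using hcont.tendsto.mono_left nhdsWithin_le_nhds

theorem tendsto_sinh_mul_legendreQ1 {α : ℂ} (hα : -1 < α.re) :
    Tendsto (fun τ => Real.sinh τ * legendreQ1 α (Real.cosh τ)) (𝓝[>] 0) (𝓝 (-1)) := by
  obtain ⟨ε, hε, hεα, hε1⟩ := exists_pos_le_neg_re_lt_one (re_neg_sub_one_neg hα)
  have hfactor : Tendsto (fun τ => ‖-α - 1‖ * (2 * Real.sinh τ + 1)) (𝓝[>] 0)
      (𝓝 (‖-α - 1‖ * (2 * Real.sinh 0 + 1))) :=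
    (by fun_prop : Continuous fun τ => ‖-α - 1‖ * (2 * Real.sinh τ + 1)).tendsto 0
      |>.mono_left nhdsWithin_le_nhds
  have hbound := hfactor.mul (tendsto_sinh_mul_rpow_neg hε1)
  rw [mul_zero] at hbound
  have hsum : Tendsto (fun τ => Real.sinh τ * legendreQ1 α (Real.cosh τ)
      + laplaceKernel (-α - 1) 1 τ) (𝓝[>] 0) (𝓝 0) := by
    refine squeeze_zero_norm' ?_ hbound
    filter_upwards [self_mem_nhdsWithin] with τ hτ
    rw [legendreQ1_cosh hα hτ]
    exact norm_sinh_mul_laplaceIntegralDeriv_cosh_add_le hε hεα hτ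
  simpa using hsum.sub (tendsto_laplaceKernel_one (-α - 1))

end SecondKindAtZero

section LegendreSystem

theorem alpha0_re : alpha0.re = -(1 / 2) := by
  simp [alpha0]; norm_num

theorem alpha0_mul_add_one : alpha0 * (alpha0 + 1) = ((-1 : ℝ) : ℂ) := by
  have hsqrt : ((Real.sqrt 3 : ℝ) : ℂ) ^ 2 = 3 := by
    exact_mod_cast Real.sq_sqrt (by norm_num : (0 : ℝ) ≤ 3)
  rw [alpha0, Complex.ofReal_neg, Complex.ofReal_one]
  linear_combination (1 / 4) * Complex.I ^ 2 * hsqrt + (3 / 4) * Complex.I_sq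

theorem neg_one_lt_alpha0_re : -1 < alpha0.re := by
  rw [alpha0_re]; norm_num

theorem isRadialSolutionOn_pc : IsRadialSolutionOn univ (-1) 0 pc pc1 :=
  (alpha0_mul_add_one ▸ isRadialSolutionOn_legendreP alpha0).re

theorem isRadialSolutionOn_qc : IsRadialSolutionOn univ (-1) 0 qc qc1 :=
  (alpha0_mul_add_one ▸ isRadialSolutionOn_legendreQ neg_one_lt_alpha0_re).re

/-- The functions `P, P¹, Q, Q¹` of the statement as a fundamental system. -/
def legendreSystem : RadialSystem (-1) where
  p := pc
  dp := pc1
  q := qc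
  dq := qc1
  isRadialSolutionOn_p := isRadialSolutionOn_pc
  isRadialSolutionOn_q := isRadialSolutionOn_qc
  continuousOn_p := Complex.continuous_re.comp_continuousOn (continuousOn_legendreP_cosh alpha0)
  continuousOn_dp := Complex.continuous_re.comp_continuousOn (continuousOn_legendreP1_cosh alpha0)
  p_zero := by rw [pc, Real.cosh_zero, legendreP_one, Complex.one_re]
  tendsto_sinh_mul_q := by
    simpa only [Function.comp_def, qc, Complex.re_ofReal_mul, Complex.zero_re] using
      (Complex.continuous_re.tendsto 0).comp (tendsto_sinh_mul_legendreQ neg_one_lt_alpha0_re)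
  tendsto_sinh_mul_dq := by
    simpa only [Function.comp_def, qc1, Complex.re_ofReal_mul, Complex.neg_re,
      Complex.one_re] using
      (Complex.continuous_re.tendsto (-1)).comp (tendsto_sinh_mul_legendreQ1 neg_one_lt_alpha0_re)

theorem integrableOn_pc_cube_mul_sinh :
    IntegrableOn (fun s : ℝ => pc s ^ 3 * Real.sinh s) (Ioi 0) :=
  isRadialSolutionOn_pc.integrableOn_pow_mul_sinh (by norm_num) legendreSystem.continuousOn_p
    (by norm_num)

theorem tendsto_integral_pc_cube_sub_calI :
    Tendsto (fun τ => (∫ s in (0 : ℝ)..τ, pc s ^ 3 * Real.sinh s) - calI) atTop (𝓝 0) := by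
  simpa [calI] using (intervalIntegral_tendsto_integral_Ioi 0 integrableOn_pc_cube_mul_sinh
    tendsto_id).sub_const calI

end LegendreSystem

section FixedPoint

variable {𝕜 E Y : Type*} [RCLike 𝕜] [NormedAddCommGroup E] [NormedSpace 𝕜 E]
  [NormedAddCommGroup Y] [NormedSpace 𝕜 Y] {G : E × Y → Y}

theorem exists_norm_sub_le_of_fderiv_comp_inr_eq_zero
    (hG : HasStrictFDerivAt G (fderiv 𝕜 G 0) 0) (hGY : fderiv 𝕜 G 0 ∘L .inr 𝕜 E Y = 0)
    {c : ℝ} (hc : 0 < c) :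
    ∃ R > 0, ∀ (q : E) (U V : Y), ‖q‖ < R → ‖U‖ < R → ‖V‖ < R →
      ‖G (q, U) - G (q, V)‖ ≤ c * ‖U - V‖ := by
  obtain ⟨R, hR, hball⟩ := Metric.eventually_nhds_iff_ball.1 (hG.isLittleO.def hc)
  refine ⟨R, hR, fun q U V hq hU hV => ?_⟩
  have hmem : ((q, U), (q, V)) ∈ Metric.ball (0 : (E × Y) × (E × Y)) R := by
    simpa [Prod.norm_def] using ⟨⟨hq, hU⟩, hq, hV⟩
  have hvert : fderiv 𝕜 G 0 (0, U - V) = 0 := DFunLike.congr_fun hGY (U - V)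
  simpa [hvert] using hball _ hmem

theorem exists_contDiffOn_fixedPoint [CompleteSpace E] [CompleteSpace Y] {n : ℕ∞ω}
    (hn : n ≠ 0) (hn' : n ≠ ∞) (hG : ContDiffAt 𝕜 n G 0) (hG0 : G 0 = 0)
    (hGY : fderiv 𝕜 G 0 ∘L .inr 𝕜 E Y = 0) :
    ∃ R > 0, ∃ r > 0, ∃ Φ : E → Y, ContDiffOn 𝕜 n Φ (Metric.ball 0 r) ∧
      ∀ q ∈ Metric.ball 0 r, Φ q = G (q, Φ q) ∧ ‖Φ q‖ ≤ 2 * ‖G (q, 0)‖ ∧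
        ∀ U, ‖U‖ < R → U = G (q, U) → U = Φ q := by
  obtain ⟨R, hR, hlip⟩ := exists_norm_sub_le_of_fderiv_comp_inr_eq_zero
    (hG.hasStrictFDerivAt hn) hGY one_half_pos
  set f : E × Y → Y := fun z => z.2 - G z
  have hf : ContDiffAt 𝕜 n f 0 := contDiffAt_snd.sub hG
  have hinv : (fderiv 𝕜 f 0 ∘L .inr 𝕜 E Y).IsInvertible := by
    rw [(hasFDerivAt_snd.fun_sub (hG.differentiableAt hn).hasFDerivAt).fderiv,
      ContinuousLinearMap.sub_comp, hGY, sub_zero, ContinuousLinearMap.snd_comp_inr]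
    exact ⟨.refl 𝕜 Y, rfl⟩
  have hΦ := hf.contDiffAt_implicitFunction hn hinv
  have hzero : hf.implicitFunction hn hinv 0 = 0 := hf.implicitFunction_apply_self hn hinv
  set Φ := hf.implicitFunction hn hinv
  have hsmall : ∀ᶠ q in 𝓝 (0 : E), ‖Φ q‖ < R :=
    hΦ.continuousAt.norm.eventually_lt_const (by simpa [hzero] using hR)
  obtain ⟨r, hr, hball⟩ := Metric.eventually_nhds_iff_ball.1 ((hΦ.eventually hn').and
    ((hf.eventually_apply_implicitFunction hn hinv).and
      (hsmall.and (Metric.ball_mem_nhds (0 : E) hR))))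
  refine ⟨R, hR, r, hr, Φ, fun q hq => (hball q hq).1.contDiffWithinAt, fun q hq => ?_⟩
  obtain ⟨-, hfix, hΦR, hqR⟩ := hball q hq
  have hfix : Φ q = G (q, Φ q) := by
    simpa [f, hG0, sub_eq_zero] using hfix
  have hcontract (U : Y) (hU : ‖U‖ < R) : ‖G (q, Φ q) - G (q, U)‖ ≤ 1 / 2 * ‖Φ q - U‖ :=
    hlip q _ U (mem_ball_zero_iff.1 hqR) hΦR hU
  refine ⟨hfix, ?_, fun U hU hUfix => ?_⟩
  · have h := hcontract 0 (by simpa using hR)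
    rw [← hfix, sub_zero] at h
    linarith [norm_le_norm_add_norm_sub' (Φ q) (G (q, 0))]
  · have h := hcontract U hU
    rw [← hfix, ← hUfix] at h
    exact (sub_eq_zero.1 (norm_le_zero_iff.1 (by linarith))).symm

end FixedPoint

section Cubic

variable {X Y D : Type*} [NormedCommRing X] [NormedAlgebra ℝ X]
  [NormedAddCommGroup Y] [NormedSpace ℝ Y] [NormedAddCommGroup D] [NormedSpace ℝ D]

/-- The nonlinearity `λ u + ν u² - η u³`. -/
def cubic (ν η lam : ℝ) (u : X) : X := lam • u + ν • u ^ 2 - η • u ^ 3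

@[simp] theorem cubic_zero (ν η lam : ℝ) : cubic ν η lam (0 : X) = 0 := by simp [cubic]

theorem contDiff_cubic (ν η : ℝ) {n : ℕ∞ω} :
    ContDiff ℝ n (fun z : ℝ × X => cubic ν η z.1 z.2) := by
  unfold cubic
  fun_prop

theorem hasFDerivAt_cubic_zero (ν η : ℝ) :
    HasFDerivAt (fun z : ℝ × X => cubic ν η z.1 z.2) (0 : ℝ × X →L[ℝ] X) 0 := by
  have hfst : HasFDerivAt (Prod.fst : ℝ × X → ℝ) (.fst ℝ ℝ X) 0 := hasFDerivAt_fst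
  have hsnd : HasFDerivAt (Prod.snd : ℝ × X → X) (.snd ℝ ℝ X) 0 := hasFDerivAt_snd
  refine (((hfst.smul hsnd).add ((hsnd.pow 2).const_smul ν)).sub
    ((hsnd.pow 3).const_smul η)).congr_fderiv ?_
  ext z <;> simp

/-- `U` solves the cubic equation `U = T d + K (λ u + ν u² - η u³)`, `u = p U`, and lies on the
branch of solutions of size comparable to the linear part `T d`. -/
structure IsSmallSolution (ν η lam : ℝ) (p : Y →L[ℝ] X) (K : X →L[ℝ] Y) (T : D →L[ℝ] Y) (d : D)
    (U : Y) : Prop where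
  eq : U = T d + K (cubic ν η lam (p U))
  norm_le : ‖U‖ ≤ 2 * ‖T d‖

theorem exists_contDiffOn_cubic_fixedPoint [CompleteSpace Y] [CompleteSpace D] (ν η : ℝ)
    (p : Y →L[ℝ] X) (K : X →L[ℝ] Y) (T : D →L[ℝ] Y) :
    ∃ R > 0, ∃ r > 0, ∃ Φ : D × ℝ → Y, ContDiffOn ℝ ω Φ (Metric.ball 0 r) ∧
      ∀ q ∈ Metric.ball 0 r, IsSmallSolution ν η q.2 p K T q.1 (Φ q) ∧
        ∀ U, ‖U‖ < R → U = T q.1 + K (cubic ν η q.2 (p U)) → U = Φ q := by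
  set L : (D × ℝ) × Y →L[ℝ] ℝ × X :=
    ((ContinuousLinearMap.snd ℝ D ℝ).comp (.fst ℝ (D × ℝ) Y)).prod (p.comp (.snd ℝ (D × ℝ) Y))
  set S : (D × ℝ) × Y →L[ℝ] Y :=
    (T.comp (.fst ℝ D ℝ)).comp (.fst ℝ (D × ℝ) Y)
  have hderiv : HasFDerivAt (fun z => S z + K (cubic ν η (L z).1 (L z).2)) S 0 := by
    have hcubic := hasFDerivAt_cubic_zero (X := X) ν η
    rw [← map_zero L] at hcubic
    simpa using! S.hasFDerivAt.add (K.hasFDerivAt.comp 0 (hcubic.comp 0 L.hasFDerivAt))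
  have hcontDiff : ContDiff ℝ ω fun z => S z + K (cubic ν η (L z).1 (L z).2) :=
    S.contDiff.add (K.contDiff.comp ((contDiff_cubic ν η).comp L.contDiff))
  obtain ⟨R, hR, r, hr, Φ, hΦ, hfix⟩ := exists_contDiffOn_fixedPoint (by simp) (by simp)
    hcontDiff.contDiffAt (by simp) (by rw [hderiv.fderiv]; ext; simp [S])
  refine ⟨R, hR, r, hr, Φ, hΦ, fun q hq => ?_⟩
  obtain ⟨heq, hnorm, huniq⟩ := hfix q hq
  exact ⟨⟨heq, by simpa [S, L] using hnorm⟩, huniq⟩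

theorem norm_cubic_le (ν η lam : ℝ) {u : X} {c n : ℝ} (hc : 0 ≤ c) (hn₀ : 0 ≤ n) (hn₁ : n ≤ 1)
    (hu : ‖u‖ ≤ c * n) :
    ‖cubic ν η lam u‖ ≤ (c + |ν| * c ^ 2 + |η| * c ^ 3) * (|lam| * n + n ^ 2) := by
  have hpow (k : ℕ) (hk : 0 < k) : ‖u ^ k‖ ≤ (c * n) ^ k :=
    (norm_pow_le' u hk).trans (by gcongr)
  have hcube : n ^ 3 ≤ n ^ 2 := pow_le_pow_of_le_one hn₀ hn₁ (by norm_num)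
  have hlam : 0 ≤ (|ν| * c ^ 2 + |η| * c ^ 3) * (|lam| * n) := by positivity
  calc ‖cubic ν η lam u‖ ≤ ‖lam • u‖ + ‖ν • u ^ 2‖ + ‖η • u ^ 3‖ :=
        (norm_sub_le _ _).trans (by gcongr; exact norm_add_le _ _)
    _ ≤ |lam| * (c * n) + |ν| * (c * n) ^ 2 + |η| * (c * n) ^ 3 := by
        simp only [norm_smul, Real.norm_eq_abs]
        gcongr
        exacts [hpow 2 two_pos, hpow 3 three_pos]
    _ = c * (|lam| * n) + |ν| * c ^ 2 * n ^ 2 + |η| * c ^ 3 * n ^ 3 := by ring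
    _ ≤ c * (|lam| * n) + |ν| * c ^ 2 * n ^ 2 + |η| * c ^ 3 * n ^ 2 := by gcongr
    _ ≤ (c + |ν| * c ^ 2 + |η| * c ^ 3) * (|lam| * n + n ^ 2) := by
        have : 0 ≤ c * n ^ 2 := by positivity
        linarith

theorem norm_cubic_sub_smul_sq_le (ν η lam : ℝ) {u v : X} {c c' n : ℝ} (hc : 0 ≤ c) (hc' : 0 ≤ c')
    (hn₀ : 0 ≤ n) (hn₁ : n ≤ 1) (hu : ‖u‖ ≤ c * n) (hv : ‖v‖ ≤ c * n)
    (huv : ‖u - v‖ ≤ c' * (|lam| * n + n ^ 2)) :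
    ‖cubic ν η lam u - ν • v ^ 2‖ ≤
      (c + 2 * |ν| * c * c' + |η| * c ^ 3) * (|lam| * n + n ^ 3) := by
  have hcube : ‖u ^ 3‖ ≤ (c * n) ^ 3 := (norm_pow_le' u three_pos).trans (by gcongr)
  have hlam : |lam| * n * n ≤ |lam| * n := mul_le_of_le_one_right (by positivity) hn₁
  have hsq : ‖(u - v) * (u + v)‖ ≤ c' * (|lam| * n + n ^ 2) * (c * n + c * n) :=
    (norm_mul_le _ _).trans (by gcongr; exact (norm_add_le u v).trans (add_le_add hu hv))
  have hsplit : cubic ν η lam u - ν • v ^ 2 = lam • u + ν • ((u - v) * (u + v)) - η • u ^ 3 := by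
    simp only [cubic, Algebra.smul_def]
    ring
  calc ‖cubic ν η lam u - ν • v ^ 2‖
      ≤ ‖lam • u‖ + ‖ν • ((u - v) * (u + v))‖ + ‖η • u ^ 3‖ := by
        rw [hsplit]
        exact (norm_sub_le _ _).trans (by gcongr; exact norm_add_le _ _)
    _ ≤ |lam| * (c * n) + |ν| * (c' * (|lam| * n + n ^ 2) * (c * n + c * n)) +
          |η| * (c * n) ^ 3 := by
        simp only [norm_smul, Real.norm_eq_abs]
        gcongr
    _ = c * (|lam| * n) + 2 * |ν| * c * c' * (|lam| * n * n + n ^ 3) + |η| * c ^ 3 * n ^ 3 := by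
        ring
    _ ≤ c * (|lam| * n) + 2 * |ν| * c * c' * (|lam| * n + n ^ 3) + |η| * c ^ 3 * n ^ 3 := by gcongr
    _ ≤ (c + 2 * |ν| * c * c' + |η| * c ^ 3) * (|lam| * n + n ^ 3) := by
        have : 0 ≤ |η| * c ^ 3 * (|lam| * n) := by positivity
        have : 0 ≤ c * n ^ 3 := by positivity
        linarith

section SmallSolutions

variable {Z : Type*} [NormedAddCommGroup Z] [NormedSpace ℝ Z]
  (ν η : ℝ) (p : Y →L[ℝ] X) (K : X →L[ℝ] Y) (T : D →L[ℝ] Y)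

theorem IsSmallSolution.norm_map_le {lam : ℝ} {d : D} {U : Y}
    (hU : IsSmallSolution ν η lam p K T d U) : ‖p U‖ ≤ ‖p‖ * (2 * ‖T‖) * ‖d‖ :=
  calc ‖p U‖ ≤ ‖p‖ * (2 * (‖T‖ * ‖d‖)) :=
        p.le_of_opNorm_le_of_le le_rfl (hU.norm_le.trans (by gcongr; exact T.le_opNorm d))
    _ = ‖p‖ * (2 * ‖T‖) * ‖d‖ := by ring

theorem IsSmallSolution.exists_norm_cubic_le :
    ∃ C ≥ 0, ∀ lam d U, ‖d‖ ≤ 1 → IsSmallSolution ν η lam p K T d U →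
      ‖cubic ν η lam (p U)‖ ≤ C * (|lam| * ‖d‖ + ‖d‖ ^ 2) :=
  ⟨_, by positivity, fun lam _ _ hd hU =>
    norm_cubic_le ν η lam (by positivity) (norm_nonneg _) hd hU.norm_map_le⟩

theorem IsSmallSolution.exists_norm_cubic_sub_le :
    ∃ C ≥ 0, ∀ lam d U, ‖d‖ ≤ 1 → IsSmallSolution ν η lam p K T d U →
      ‖cubic ν η lam (p U) - ν • p (T d) ^ 2‖ ≤ C * (|lam| * ‖d‖ + ‖d‖ ^ 3) := by
  obtain ⟨C, hC₀, hC⟩ := IsSmallSolution.exists_norm_cubic_le ν η p K T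
  refine ⟨_, ?_, fun lam d U hd hU => norm_cubic_sub_smul_sq_le ν η lam
    (c := ‖p‖ * (2 * ‖T‖)) (c' := ‖p ∘L K‖ * C) (by positivity) (by positivity) (norm_nonneg d) hd
    hU.norm_map_le ?_ ?_⟩
  · positivity
  · refine (p.le_of_opNorm_le_of_le le_rfl (T.le_opNorm d)).trans ?_
    rw [mul_assoc]
    gcongr
    linarith [norm_nonneg T]
  · have hsub : p U - p (T d) = (p ∘L K) (cubic ν η lam (p U)) := by
      rw [← map_sub, sub_eq_of_eq_add' hU.eq]
      rfl
    rw [hsub, mul_assoc]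
    exact (p ∘L K).le_of_opNorm_le_of_le le_rfl (hC lam d U hd hU)

variable {T} (L : Y →L[ℝ] Z) (hLT : ∀ d, L (T d) = 0)
include hLT

theorem IsSmallSolution.map_eq {p : Y →L[ℝ] X} {K : X →L[ℝ] Y} {ν η lam : ℝ} {d : D} {U : Y}
    (hU : IsSmallSolution ν η lam p K T d U) : L U = L (K (cubic ν η lam (p U))) := by
  conv_lhs => rw [hU.eq, map_add, hLT, zero_add]

theorem IsSmallSolution.exists_norm_map_le :
    ∃ C ≥ 0, ∀ lam d U, ‖d‖ ≤ 1 → IsSmallSolution ν η lam p K T d U →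
      ‖L U‖ ≤ C * (|lam| * ‖d‖ + ‖d‖ ^ 2) := by
  obtain ⟨C, hC₀, hC⟩ := IsSmallSolution.exists_norm_cubic_le ν η p K T
  refine ⟨‖L ∘L K‖ * C, by positivity, fun lam d U hd hU => ?_⟩
  rw [hU.map_eq L hLT, mul_assoc]
  exact (L ∘L K).le_of_opNorm_le_of_le le_rfl (hC lam d U hd hU)

theorem IsSmallSolution.exists_norm_map_sub_le :
    ∃ C ≥ 0, ∀ lam d U, ‖d‖ ≤ 1 → IsSmallSolution ν η lam p K T d U →
      ‖L U - ν • L (K (p (T d) ^ 2))‖ ≤ C * (|lam| * ‖d‖ + ‖d‖ ^ 3) := by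
  obtain ⟨C, hC₀, hC⟩ := IsSmallSolution.exists_norm_cubic_sub_le ν η p K T
  refine ⟨‖L ∘L K‖ * C, by positivity, fun lam d U hd hU => ?_⟩
  rw [hU.map_eq L hLT, mul_assoc, ← map_smul, ← map_smul, ← map_sub, ← map_sub]
  exact (L ∘L K).le_of_opNorm_le_of_le le_rfl (hC lam d U hd hU)

end SmallSolutions

end Cubic

section CurveOperators

namespace RadialSystem

variable {κ : ℝ} (S : RadialSystem κ) {b : ℝ} (hb : 0 < b)

/-- The regular solution `p` as an element of `C([0, b])`. -/
def pMap (b : ℝ) : C(Icc (0 : ℝ) b, ℝ) :=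
  ⟨fun τ => S.p τ, continuousOn_iff_continuous_domRestrict.1
    (S.continuousOn_p.mono Icc_subset_Ici_self)⟩

/-- The derivative `dp` of the regular solution as an element of `C([0, b])`. -/
def dpMap (b : ℝ) : C(Icc (0 : ℝ) b, ℝ) :=
  ⟨fun τ => S.dp τ, continuousOn_iff_continuous_domRestrict.1
    (S.continuousOn_dp.mono Icc_subset_Ici_self)⟩

theorem isRadialSolutionOn_IccExtend (c : ℝ) (F : C(Icc (0 : ℝ) b, ℝ)) :
    IsRadialSolutionOn (Icc 0 b) κ (IccExtend hb.le F)
      (IccExtend hb.le (c • S.pMap b + S.duhamelOp S.isDuhamelPair hb.le F))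
      (IccExtend hb.le (c • S.dpMap b + S.duhamelOp S.isDuhamelPair_deriv hb.le F)) := by
  have h := ((S.isRadialSolutionOn_p.mono (subset_univ (Icc 0 b))).const_mul c).add
    (S.isRadialSolutionOn_duhamel (Icc 0 b) (F.continuous.Icc_extend' (h := hb.le)).continuousOn)
  simp only [Pi.zero_apply, mul_zero, zero_add] at h
  exact h.congr (fun τ hτ _ => by rw [IccExtend_of_mem hb.le _ hτ]; rfl)
    fun τ hτ _ => by rw [IccExtend_of_mem hb.le _ hτ]; rfl

theorem isRadialSolutionOn_IccExtend_iff {F u v : C(Icc (0 : ℝ) b, ℝ)} :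
    IsRadialSolutionOn (Icc 0 b) κ (IccExtend hb.le F) (IccExtend hb.le u) (IccExtend hb.le v) ↔
      ∃ c : ℝ, u = c • S.pMap b + S.duhamelOp S.isDuhamelPair hb.le F ∧
        v = c • S.dpMap b + S.duhamelOp S.isDuhamelPair_deriv hb.le F := by
  refine ⟨fun h => ?_, ?_⟩
  · have hcont (f : C(Icc (0 : ℝ) b, ℝ)) : Continuous (IccExtend hb.le f) :=
      f.continuous.Icc_extend'
    obtain ⟨c, hu, hv⟩ := S.exists_eq_const_mul_add_duhamel hb (hcont F).continuousOn
      (hcont u).continuousOn (hcont v).continuousOn h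
    refine ⟨c, ContinuousMap.ext fun τ => ?_, ContinuousMap.ext fun τ => ?_⟩
    · exact (IccExtend_val hb.le u τ).symm.trans (hu τ.2)
    · exact (IccExtend_val hb.le v τ).symm.trans (hv τ.2)
  · rintro ⟨c, rfl, rfl⟩
    exact S.isRadialSolutionOn_IccExtend hb c F

end RadialSystem

/-- The `i`-th coordinate of a curve in phase space. -/
def coord (b : ℝ) (i : Fin 4) : C(Icc (0 : ℝ) b, E4) →L[ℝ] C(Icc (0 : ℝ) b, ℝ) :=
  (EuclideanSpace.proj i : E4 →L[ℝ] ℝ).compLeftContinuous ℝ _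

theorem coord_apply {b : ℝ} (i : Fin 4) (U : C(Icc (0 : ℝ) b, E4)) (τ : Icc (0 : ℝ) b) :
    coord b i U τ = U τ i := rfl

/-- The curve in phase space with given coordinates. -/
def ofCoords (b : ℝ) : (Fin 4 → C(Icc (0 : ℝ) b, ℝ)) →L[ℝ] C(Icc (0 : ℝ) b, E4) :=
  ∑ i, ((ContinuousLinearMap.toSpanSingleton ℝ
    (EuclideanSpace.single i (1 : ℝ) : E4)).compLeftContinuous ℝ _).comp (.proj i)

theorem ofCoords_apply {b : ℝ} (f : Fin 4 → C(Icc (0 : ℝ) b, ℝ)) (τ : Icc (0 : ℝ) b) (j : Fin 4) :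
    ofCoords b f τ j = f j τ := by
  simp [ofCoords, ContinuousMap.sum_apply, Pi.single_apply]

theorem coord_ofCoords {b : ℝ} (f : Fin 4 → C(Icc (0 : ℝ) b, ℝ)) (j : Fin 4) :
    coord b j (ofCoords b f) = f j :=
  ContinuousMap.ext fun τ => ofCoords_apply f τ j

theorem curve_ext_iff {b : ℝ} {U W : C(Icc (0 : ℝ) b, E4)} :
    U = W ↔ ∀ i, coord b i U = coord b i W :=
  ⟨fun h _ => h ▸ rfl, fun h => ContinuousMap.ext fun τ => by
    ext i
    exact DFunLike.congr_fun (h i) τ⟩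

end CurveOperators

section CoreEquation

variable {τ₀ : ℝ} (h : 0 < τ₀)

/-- The operator taking `F` to the solution of `u'' + coth τ · u' = -u + F` on `[0, τ₀]` that
vanishes with its derivative at `0`. -/
def green : C(Icc (0 : ℝ) τ₀, ℝ) →L[ℝ] C(Icc (0 : ℝ) τ₀, ℝ) :=
  legendreSystem.duhamelOp legendreSystem.isDuhamelPair h.le

/-- The derivative of the solution given by `green`. -/
def greenDeriv : C(Icc (0 : ℝ) τ₀, ℝ) →L[ℝ] C(Icc (0 : ℝ) τ₀, ℝ) :=
  legendreSystem.duhamelOp legendreSystem.isDuhamelPair_deriv h.le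

/-- The solution of the linear system with a forcing in the fourth component that is regular at `0`
and has `u₁ 0 = u₂ 0 = 0`. -/
def particularSol : C(Icc (0 : ℝ) τ₀, ℝ) →L[ℝ] C(Icc (0 : ℝ) τ₀, E4) :=
  (ofCoords τ₀).comp (.pi ![(green h).comp (green h), green h, (greenDeriv h).comp (green h),
    greenDeriv h])

/-- The regular solution of the homogeneous linear system with `(u₁ 0, u₂ 0) = x`. -/
def regularSol : E2 →L[ℝ] C(Icc (0 : ℝ) τ₀, E4) :=
  let p := legendreSystem.pMap τ₀
  let dp := legendreSystem.dpMap τ₀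
  (EuclideanSpace.proj 0 : E2 →L[ℝ] ℝ).smulRight (ofCoords τ₀ ![p, 0, dp, 0]) +
    (EuclideanSpace.proj 1 : E2 →L[ℝ] ℝ).smulRight
      (ofCoords τ₀ ![green h p, p, greenDeriv h p, dp])

theorem coord_particularSol (f : C(Icc (0 : ℝ) τ₀, ℝ)) (i : Fin 4) :
    coord τ₀ i (particularSol h f) =
      ![green h (green h f), green h f, greenDeriv h (green h f), greenDeriv h f] i := by
  rw [particularSol, ContinuousLinearMap.comp_apply, coord_ofCoords]
  fin_cases i <;> rfl

theorem coord_regularSol (x : E2) (i : Fin 4) :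
    coord τ₀ i (regularSol h x) =
      x 0 • ![legendreSystem.pMap τ₀, 0, legendreSystem.dpMap τ₀, 0] i +
        x 1 • ![green h (legendreSystem.pMap τ₀), legendreSystem.pMap τ₀,
          greenDeriv h (legendreSystem.pMap τ₀), legendreSystem.dpMap τ₀] i := by
  simp only [regularSol, add_apply, ContinuousLinearMap.smulRight_apply, map_add, map_smul,
    coord_ofCoords, PiLp.proj_apply]

theorem radialMoment_IccExtend_pMap (w : ℝ → ℝ) (τ : Icc (0 : ℝ) τ₀) :
    radialMoment w (IccExtend h.le (legendreSystem.pMap τ₀)) τ =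
      ∫ s in (0 : ℝ)..τ, w s * pc s * Real.sinh s := by
  refine intervalIntegral.integral_congr fun s hs => ?_
  rw [uIcc_of_le τ.2.1] at hs
  simp only [IccExtend_of_mem h.le _ (⟨hs.1, hs.2.trans τ.2.2⟩ : s ∈ Icc 0 τ₀)]
  rfl

theorem radialMoment_pc_pMap (τ : Icc (0 : ℝ) τ₀) :
    radialMoment pc (IccExtend h.le (legendreSystem.pMap τ₀)) τ = intPP τ := by
  simp only [radialMoment_IccExtend_pMap h, intPP, sq]

theorem radialMoment_qc_pMap (τ : Icc (0 : ℝ) τ₀) :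
    radialMoment qc (IccExtend h.le (legendreSystem.pMap τ₀)) τ = intPQ τ := by
  simp only [radialMoment_IccExtend_pMap h, intPQ, mul_comm (pc _)]

theorem regularSol_apply (x : E2) (τ : Icc (0 : ℝ) τ₀) :
    regularSol h x τ = x 0 • V1 τ + x 1 • V2 τ := by
  have hgreen : green h (legendreSystem.pMap τ₀) τ = pc τ * intPQ τ - qc τ * intPP τ := by
    rw [← radialMoment_pc_pMap h, ← radialMoment_qc_pMap h]; rfl
  have hgreenDeriv : greenDeriv h (legendreSystem.pMap τ₀) τ =
      pc1 τ * intPQ τ - qc1 τ * intPP τ := by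
    rw [← radialMoment_pc_pMap h, ← radialMoment_qc_pMap h]; rfl
  have hp : legendreSystem.pMap τ₀ τ = pc τ := rfl
  have hdp : legendreSystem.dpMap τ₀ τ = pc1 τ := rfl
  ext i
  rw [← coord_apply, coord_regularSol]
  fin_cases i <;> simp [V1, V2, hgreen, hgreenDeriv, hp, hdp]

theorem coreField_apply (ν η lam τ : ℝ) (u : E4) :
    (coreA τ).toEuclideanLin u + coreF ν η lam u =
      !₂[u 2, u 3, -u 0 + u 1 - Real.cosh τ / Real.sinh τ * u 2,
        -u 1 - Real.cosh τ / Real.sinh τ * u 3 + (lam * u 0 + ν * u 0 ^ 2 - η * u 0 ^ 3)] := by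
  ext j
  fin_cases j <;> simp [coreA, coreF, Matrix.toLpLin_apply, dotProduct, Fin.sum_univ_four] <;> ring

theorem hasDerivWithinAt_IccExtend_iff_coord {U : C(Icc (0 : ℝ) τ₀, E4)} {v : E4} {s : Set ℝ}
    {τ : ℝ} : HasDerivWithinAt (IccExtend h.le U) v s τ ↔
      ∀ i, HasDerivWithinAt (IccExtend h.le (coord τ₀ i U)) (v i) s τ := by
  simp only [hasDerivWithinAt_iff_hasFDerivWithinAt]
  rw [hasFDerivWithinAt_euclidean]
  refine forall_congr' fun i => ?_
  have hcomp : (EuclideanSpace.proj i : E4 →L[ℝ] ℝ).comp (.toSpanSingleton ℝ v) =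
      .toSpanSingleton ℝ (v i) := by
    ext; simp
  rw [hcomp]
  rfl

theorem isCoreSolution_iff_isRadialSolutionOn {ν η lam : ℝ} {U : C(Icc (0 : ℝ) τ₀, E4)} :
    IsCoreSolution ν η lam h U ↔
      IsRadialSolutionOn (Icc 0 τ₀) (-1) (IccExtend h.le (coord τ₀ 1 U))
        (IccExtend h.le (coord τ₀ 0 U)) (IccExtend h.le (coord τ₀ 2 U)) ∧
      IsRadialSolutionOn (Icc 0 τ₀) (-1)
        (IccExtend h.le (cubic ν η lam (coord τ₀ 0 U) : C(Icc (0 : ℝ) τ₀, ℝ)))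
        (IccExtend h.le (coord τ₀ 1 U)) (IccExtend h.le (coord τ₀ 3 U)) := by
  have hext (f : C(Icc (0 : ℝ) τ₀, ℝ)) {τ : ℝ} (hτ : τ ∈ Icc 0 τ₀) :
      IccExtend h.le f τ = f ⟨τ, hτ⟩ := IccExtend_of_mem h.le f hτ
  simp only [IsCoreSolution, hasDerivWithinAt_IccExtend_iff_coord h, coreField_apply]
  constructor
  · intro H
    refine ⟨fun τ hτ hpos => ⟨?_, ?_⟩, fun τ hτ hpos => ⟨?_, ?_⟩⟩ <;> simp only [hext _ hτ]
    · exact H ⟨τ, hτ⟩ hpos 0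
    · exact (H ⟨τ, hτ⟩ hpos 2).congr_deriv (by simp [coord_apply]; ring)
    · exact H ⟨τ, hτ⟩ hpos 1
    · exact (H ⟨τ, hτ⟩ hpos 3).congr_deriv (by simp [coord_apply, cubic])
  · rintro ⟨H₁, H₂⟩ ⟨τ, hτ⟩ hpos i
    have hU₁ := H₁ τ hτ hpos
    have hU₂ := H₂ τ hτ hpos
    simp only [hext _ hτ] at hU₁ hU₂
    fin_cases i
    · exact hU₁.1
    · exact hU₂.1
    · exact hU₁.2.congr_deriv (by simp [coord_apply]; ring)
    · exact hU₂.2.congr_deriv (by simp [coord_apply, cubic])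

theorem eq_regularSol_add_particularSol_iff {x : E2} {f : C(Icc (0 : ℝ) τ₀, ℝ)}
    {U : C(Icc (0 : ℝ) τ₀, E4)} :
    U = regularSol h x + particularSol h f ↔
      (coord τ₀ 0 U = x 0 • legendreSystem.pMap τ₀ + green h (coord τ₀ 1 U) ∧
        coord τ₀ 2 U = x 0 • legendreSystem.dpMap τ₀ + greenDeriv h (coord τ₀ 1 U)) ∧
      (coord τ₀ 1 U = x 1 • legendreSystem.pMap τ₀ + green h f ∧
        coord τ₀ 3 U = x 1 • legendreSystem.dpMap τ₀ + greenDeriv h f) := by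
  rw [curve_ext_iff]
  simp only [map_add, coord_regularSol, coord_particularSol, Fin.forall_fin_succ]
  constructor
  · rintro ⟨h0, h1, h2, h3, -⟩
    simp only [Fin.isValue, Nat.succ_eq_add_one, Nat.reduceAdd, Matrix.cons_val_zero,
      Fin.succ_zero_eq_one, Matrix.cons_val_one, smul_zero, zero_add, Fin.succ_one_eq_two,
      Matrix.cons_val, Fin.reduceSucc] at h0 h1 h2 h3
    rw [h1]
    simp [h0, h2, h3, add_assoc]
  · rintro ⟨⟨h0, h2⟩, h1, h3⟩
    rw [h1] at h0 h2
    simp [h0, h1, h2, h3, add_assoc]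

theorem isCoreSolution_iff_exists {ν η lam : ℝ} {U : C(Icc (0 : ℝ) τ₀, E4)} :
    IsCoreSolution ν η lam h U ↔
      ∃ x : E2, U = regularSol h x + particularSol h (cubic ν η lam (coord τ₀ 0 U)) := by
  rw [isCoreSolution_iff_isRadialSolutionOn, legendreSystem.isRadialSolutionOn_IccExtend_iff h,
    legendreSystem.isRadialSolutionOn_IccExtend_iff h]
  simp only [eq_regularSol_add_particularSol_iff]
  constructor
  · rintro ⟨⟨a, hfst⟩, c, hsnd⟩
    exact ⟨!₂[a, c], hfst, hsnd⟩
  · rintro ⟨x, hfst, hsnd⟩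
    exact ⟨⟨x 0, hfst⟩, x 1, hsnd⟩

end CoreEquation

section Frame

theorem sinh_mul_wronskian_legendre {τ : ℝ} (hτ : 0 < τ) :
    Real.sinh τ * (pc1 τ * qc τ - pc τ * qc1 τ) = 1 :=
  legendreSystem.sinh_mul_wronskian hτ

/-- The coefficient of `(P, P¹)` in the expansion of `(u i, u j)` in `(P, P¹)` and `(Q, Q¹)`. -/
def coefP (τ : ℝ) (i j : Fin 4) : E4 →L[ℝ] ℝ :=
  Real.sinh τ • (qc τ • EuclideanSpace.proj j - qc1 τ • EuclideanSpace.proj i)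

/-- The coefficient of `(Q, Q¹)` in the expansion of `(u i, u j)` in `(P, P¹)` and `(Q, Q¹)`. -/
def coefQ (τ : ℝ) (i j : Fin 4) : E4 →L[ℝ] ℝ :=
  -(Real.sinh τ • (pc τ • EuclideanSpace.proj j - pc1 τ • EuclideanSpace.proj i))

theorem coefP_apply (τ : ℝ) (i j : Fin 4) (u : E4) :
    coefP τ i j u = Real.sinh τ * (qc τ * u j - qc1 τ * u i) := rfl

theorem coefQ_apply (τ : ℝ) (i j : Fin 4) (u : E4) :
    coefQ τ i j u = -(Real.sinh τ * (pc τ * u j - pc1 τ * u i)) := rfl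

theorem coefP_eq {τ : ℝ} (hτ : 0 < τ) {i j : Fin 4} {u : E4} {x y : ℝ}
    (hi : u i = x * pc τ + y * qc τ) (hj : u j = x * pc1 τ + y * qc1 τ) : coefP τ i j u = x := by
  rw [coefP_apply, hi, hj]
  linear_combination x * sinh_mul_wronskian_legendre hτ

theorem coefQ_eq {τ : ℝ} (hτ : 0 < τ) {i j : Fin 4} {u : E4} {x y : ℝ}
    (hi : u i = x * pc τ + y * qc τ) (hj : u j = x * pc1 τ + y * qc1 τ) : coefQ τ i j u = y := by
  rw [coefQ_apply, hi, hj]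
  linear_combination y * sinh_mul_wronskian_legendre hτ

/-- The coordinates of a vector with respect to the frame `V₁(τ), …, V₄(τ)`. -/
def frameCoef (τ : ℝ) : Fin 4 → E4 →L[ℝ] ℝ :=
  ![coefP τ 0 2 - intPQ τ • coefP τ 1 3 - intQQ τ • coefQ τ 1 3, coefP τ 1 3,
    coefQ τ 0 2 + intPP τ • coefP τ 1 3 + intPQ τ • coefQ τ 1 3, coefQ τ 1 3]

theorem frameCoef_apply (τ : ℝ) (i : Fin 4) (u : E4) :
    frameCoef τ i u =
      ![coefP τ 0 2 u - intPQ τ * coefP τ 1 3 u - intQQ τ * coefQ τ 1 3 u, coefP τ 1 3 u,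
        coefQ τ 0 2 u + intPP τ * coefP τ 1 3 u + intPQ τ * coefQ τ 1 3 u, coefQ τ 1 3 u] i := by
  fin_cases i <;> rfl

theorem sum_smul_frame (τ : ℝ) (c : Fin 4 → ℝ) :
    ∑ j, c j • frame τ j = c 0 • V1 τ + c 1 • V2 τ + c 2 • V3 τ + c 3 • V4 τ := by
  rw [Fin.sum_univ_four]
  rfl

theorem sum_smul_frame_apply (τ : ℝ) (c : Fin 4 → ℝ) (i : Fin 4) :
    (∑ j, c j • frame τ j) i =
      ![(c 0 + c 1 * intPQ τ + c 3 * intQQ τ) * pc τ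
          + (c 2 - c 1 * intPP τ - c 3 * intPQ τ) * qc τ,
        c 1 * pc τ + c 3 * qc τ,
        (c 0 + c 1 * intPQ τ + c 3 * intQQ τ) * pc1 τ
          + (c 2 - c 1 * intPP τ - c 3 * intPQ τ) * qc1 τ,
        c 1 * pc1 τ + c 3 * qc1 τ] i := by
  rw [sum_smul_frame]
  fin_cases i <;> simp [V1, V2, V3, V4] <;> ring

theorem frameCoef_sum_smul_frame {τ : ℝ} (hτ : 0 < τ) (c : Fin 4 → ℝ) (i : Fin 4) :
    frameCoef τ i (∑ j, c j • frame τ j) = c i := by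
  have hu := sum_smul_frame_apply τ c
  rw [frameCoef_apply, coefP_eq hτ (hu 0) (hu 2), coefQ_eq hτ (hu 0) (hu 2),
    coefP_eq hτ (hu 1) (hu 3), coefQ_eq hτ (hu 1) (hu 3)]
  fin_cases i <;> simp <;> ring

theorem sum_frameCoef_smul_frame {τ : ℝ} (hτ : 0 < τ) (u : E4) :
    ∑ j, frameCoef τ j u • frame τ j = u := by
  ext i
  simp only [sum_smul_frame_apply, frameCoef_apply, coefP_apply, coefQ_apply]
  fin_cases i <;> simp
  · linear_combination u 0 * sinh_mul_wronskian_legendre hτ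
  · linear_combination u 1 * sinh_mul_wronskian_legendre hτ
  · linear_combination u 2 * sinh_mul_wronskian_legendre hτ
  · linear_combination u 3 * sinh_mul_wronskian_legendre hτ

theorem linearIndependent_frame {τ : ℝ} (hτ : 0 < τ) : LinearIndependent ℝ (frame τ) := by
  rw [Fintype.linearIndependent_iff]
  intro c hc i
  rw [← frameCoef_sum_smul_frame hτ c i, hc, map_zero]

theorem frameMatrix_mulVec (τ : ℝ) (c : Fin 4 → ℝ) :
    (frameMatrix τ).mulVec c = (∑ j, c j • frame τ j).ofLp := by
  ext i
  simp [frameMatrix, Matrix.mulVec, dotProduct, Fin.sum_univ_four, mul_comm]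

theorem isUnit_det_frameMatrix {τ : ℝ} (hτ : 0 < τ) : IsUnit (frameMatrix τ).det := by
  rw [← Matrix.isUnit_iff_isUnit_det, ← Matrix.mulVec_injective_iff_isUnit]
  intro c c' hcc
  simp only [frameMatrix_mulVec] at hcc
  ext i
  rw [← frameCoef_sum_smul_frame hτ c i, WithLp.ofLp_injective _ hcc,
    frameCoef_sum_smul_frame hτ c' i]

theorem coreProj_sum_smul_frame {τ : ℝ} (hτ : 0 < τ) (c : Fin 4 → ℝ) :
    coreProj τ (∑ j, c j • frame τ j) = c 0 • V1 τ + c 1 • V2 τ := by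
  rw [coreProj, Matrix.toLpLin_apply, ← frameMatrix_mulVec, Matrix.mulVec_mulVec,
    Matrix.mul_assoc, Matrix.nonsing_inv_mul _ (isUnit_det_frameMatrix hτ), Matrix.mul_one,
    ← Matrix.mulVec_mulVec, frameMatrix_mulVec, WithLp.toLp_ofLp, sum_smul_frame]
  simp [Matrix.mulVec_diagonal]

theorem eq_frame_expansion_iff {τ : ℝ} (hτ : 0 < τ) {u : E4} {c : Fin 4 → ℝ} :
    u = c 0 • V1 τ + c 1 • V2 τ + c 2 • V3 τ + c 3 • V4 τ ↔ ∀ i, frameCoef τ i u = c i := by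
  rw [← sum_smul_frame]
  refine ⟨?_, fun hc => ?_⟩
  · rintro rfl i
    exact frameCoef_sum_smul_frame hτ c i
  · simp only [← hc, sum_frameCoef_smul_frame hτ]

theorem coreProj_eq_iff {τ : ℝ} (hτ : 0 < τ) {u : E4} {x y : ℝ} :
    coreProj τ u = x • V1 τ + y • V2 τ ↔ frameCoef τ 0 u = x ∧ frameCoef τ 1 u = y := by
  have hproj := coreProj_sum_smul_frame hτ (frameCoef τ · u)
  rw [sum_frameCoef_smul_frame hτ] at hproj
  rw [hproj]
  refine ⟨fun heq => ?_, fun ⟨hx, hy⟩ => by rw [hx, hy]⟩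
  have hcoef := (eq_frame_expansion_iff hτ (c := ![x, y, 0, 0])).1 (by simpa using heq)
  have hleft := (eq_frame_expansion_iff hτ
    (u := frameCoef τ 0 u • V1 τ + frameCoef τ 1 u • V2 τ)
    (c := ![frameCoef τ 0 u, frameCoef τ 1 u, 0, 0])).1 (by simp)
  exact ⟨(hleft 0).symm.trans (hcoef 0), (hleft 1).symm.trans (hcoef 1)⟩

end Frame

section EndpointUniqueness

theorem contDiffOn_coreField (ν η lam : ℝ) :
    ContDiffOn ℝ 1 (fun q : ℝ × E4 => (coreA q.1).toEuclideanLin q.2 + coreF ν η lam q.2)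
      {q | 0 < q.1} := by
  have hsnd (i : Fin 4) : ContDiffOn ℝ 1 (fun q : ℝ × E4 => q.2 i) {q | 0 < q.1} :=
    ((EuclideanSpace.proj i : E4 →L[ℝ] ℝ).contDiff.comp contDiff_snd).contDiffOn
  have hcoth : ContDiffOn ℝ 1 (fun q : ℝ × E4 => Real.cosh q.1 / Real.sinh q.1) {q | 0 < q.1} :=
    (Real.contDiff_cosh.comp contDiff_fst).contDiffOn.div
      (Real.contDiff_sinh.comp contDiff_fst).contDiffOn fun q hq => (Real.sinh_pos_iff.2 hq).ne'
  simp only [coreField_apply]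
  rw [contDiffOn_euclidean]
  intro i
  fin_cases i
  · exact hsnd 2
  · exact hsnd 3
  · exact ((hsnd 0).neg.add (hsnd 1)).sub (hcoth.mul (hsnd 2))
  · exact ((hsnd 1).neg.sub (hcoth.mul (hsnd 3))).add
      (((contDiffOn_const.mul (hsnd 0)).add (contDiffOn_const.mul ((hsnd 0).pow 2))).sub
        (contDiffOn_const.mul ((hsnd 0).pow 3)))

theorem exists_lipschitzOnWith_coreField (ν η lam : ℝ) {ε : ℝ} (hε : 0 < ε) (b R : ℝ) :
    ∃ K, ∀ t ∈ Icc ε b, LipschitzOnWith K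
      (fun u => (coreA t).toEuclideanLin u + coreF ν η lam u) (Metric.closedBall 0 R) := by
  obtain ⟨K, hK⟩ := ((contDiffOn_coreField ν η lam).mono
    (fun q (hq : q ∈ Icc ε b ×ˢ Metric.closedBall (0 : E4) R) => hε.trans_le hq.1.1))
    |>.exists_lipschitzOnWith one_ne_zero ((convex_Icc ε b).prod (convex_closedBall 0 R))
      (isCompact_Icc.prod (isCompact_closedBall 0 R))
  refine ⟨K, fun t ht u hu w hw => ?_⟩
  simpa [Prod.edist_eq] using hK (mk_mem_prod ht hu) (mk_mem_prod ht hw)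

variable {τ₀ : ℝ} (h : 0 < τ₀)

theorem IsCoreSolution.hasDerivWithinAt_Iic {ν η lam : ℝ} {U : C(Icc (0 : ℝ) τ₀, E4)}
    (hU : IsCoreSolution ν η lam h U) {t : ℝ} (ht : t ∈ Ioc 0 τ₀) :
    HasDerivWithinAt (IccExtend h.le U) ((coreA t).toEuclideanLin (IccExtend h.le U t) +
      coreF ν η lam (IccExtend h.le U t)) (Iic t) t := by
  have htI := Ioc_subset_Icc_self ht
  rw [IccExtend_of_mem h.le _ htI]
  refine (hU ⟨t, htI⟩ ht.1).mono_of_mem_nhdsWithin ?_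
  exact mem_of_superset (Ioc_mem_nhdsLE ht.1)
    (Ioc_subset_Icc_self.trans (Icc_subset_Icc_right ht.2))

theorem IsCoreSolution.eq_of_endpoint {ν η lam : ℝ} {U V : C(Icc (0 : ℝ) τ₀, E4)}
    (hU : IsCoreSolution ν η lam h U) (hV : IsCoreSolution ν η lam h V)
    (hUV : U ⟨τ₀, right_mem_Icc.2 h.le⟩ = V ⟨τ₀, right_mem_Icc.2 h.le⟩) : U = V := by
  have hcont (W : C(Icc (0 : ℝ) τ₀, E4)) : Continuous (IccExtend h.le W) :=
    W.continuous.Icc_extend'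
  have hmem {W : C(Icc (0 : ℝ) τ₀, E4)} (hW : ‖W‖ ≤ max ‖U‖ ‖V‖) (t : ℝ) :
      IccExtend h.le W t ∈ Metric.closedBall 0 (max ‖U‖ ‖V‖) :=
    mem_closedBall_zero_iff.2 ((W.norm_coe_le_norm _).trans hW)
  have heq : EqOn (IccExtend h.le U) (IccExtend h.le V) (Ioc 0 τ₀) := by
    intro ε hε
    obtain ⟨K, hK⟩ := exists_lipschitzOnWith_coreField ν η lam hε.1 τ₀ (max ‖U‖ ‖V‖)
    have hsub {t : ℝ} (ht : t ∈ Ioc ε τ₀) : t ∈ Ioc 0 τ₀ := ⟨hε.1.trans ht.1, ht.2⟩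
    exact ODE_solution_unique_of_mem_Icc_left (fun t ht => hK t (Ioc_subset_Icc_self ht))
      (hcont U).continuousOn (fun t ht => hU.hasDerivWithinAt_Iic h (hsub ht))
      (fun t _ => hmem (le_max_left _ _) t)
      (hcont V).continuousOn (fun t ht => hV.hasDerivWithinAt_Iic h (hsub ht))
      (fun t _ => hmem (le_max_right _ _) t)
      (by simpa only [IccExtend_right] using hUV) (left_mem_Icc.2 hε.2)
  have heq' := eqOn_Icc_of_eqOn_Ioc h (hcont U).continuousOn (hcont V).continuousOn heq
  refine ContinuousMap.ext fun τ => ?_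
  rw [← IccExtend_val h.le U, ← IccExtend_val h.le V]
  exact heq' τ.2

end EndpointUniqueness

section EndpointCoefficients

variable {τ₀ : ℝ} (h : 0 < τ₀)

/-- The coefficient of the `i`-th frame vector in the value of a curve at `τ₀`, counting from
`V₁(τ₀)` for `i = 0`. -/
def endCoef (i : Fin 4) : C(Icc (0 : ℝ) τ₀, E4) →L[ℝ] ℝ :=
  (frameCoef τ₀ i).comp (ContinuousMap.evalCLM ℝ ⟨τ₀, right_mem_Icc.2 h.le⟩)

theorem endCoef_apply (i : Fin 4) (U : C(Icc (0 : ℝ) τ₀, E4)) :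
    endCoef h i U = frameCoef τ₀ i (U ⟨τ₀, right_mem_Icc.2 h.le⟩) := rfl

/-- The coefficients of `V₁(τ₀)` and `V₂(τ₀)` in the value of a curve at `τ₀`, which parametrize the
core manifold. -/
def freeCoef : C(Icc (0 : ℝ) τ₀, E4) →L[ℝ] E2 :=
  ((EuclideanSpace.equiv (Fin 2) ℝ).symm : (Fin 2 → ℝ) →L[ℝ] E2).comp
    (.pi ![endCoef h 0, endCoef h 1])

theorem freeCoef_eq_iff {U : C(Icc (0 : ℝ) τ₀, E4)} {d : E2} :
    freeCoef h U = d ↔ endCoef h 0 U = d 0 ∧ endCoef h 1 U = d 1 := by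
  rw [PiLp.ext_iff, Fin.forall_fin_two]
  rfl

theorem endpoint_eq_iff {U : C(Icc (0 : ℝ) τ₀, E4)} {d : E2} {b a : ℝ} :
    U ⟨τ₀, right_mem_Icc.2 h.le⟩ = d 0 • V1 τ₀ + d 1 • V2 τ₀ + b • V3 τ₀ + a • V4 τ₀ ↔
      freeCoef h U = d ∧ endCoef h 2 U = b ∧ endCoef h 3 U = a := by
  have hiff := eq_frame_expansion_iff h (u := U ⟨τ₀, right_mem_Icc.2 h.le⟩)
    (c := ![d 0, d 1, b, a])
  simp only [← endCoef_apply h, Fin.forall_fin_succ] at hiff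
  simpa [freeCoef_eq_iff, and_assoc] using hiff

theorem coreProj_endpoint_eq_iff {U : C(Icc (0 : ℝ) τ₀, E4)} {d : E2} :
    coreProj τ₀ (U ⟨τ₀, right_mem_Icc.2 h.le⟩) = d 0 • V1 τ₀ + d 1 • V2 τ₀ ↔ freeCoef h U = d := by
  rw [coreProj_eq_iff h, freeCoef_eq_iff, endCoef_apply, endCoef_apply]

theorem freeCoef_endCoef_regularSol (x : E2) : freeCoef h (regularSol h x) = x ∧
    endCoef h 2 (regularSol h x) = 0 ∧ endCoef h 3 (regularSol h x) = 0 := by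
  rw [← endpoint_eq_iff, regularSol_apply]
  simp

/-- The solution of the forced linear system that is regular at `0` and has no component along
`V₁(τ₀)` and `V₂(τ₀)` at `τ₀`. -/
def projectedSol : C(Icc (0 : ℝ) τ₀, ℝ) →L[ℝ] C(Icc (0 : ℝ) τ₀, E4) :=
  particularSol h - regularSol h ∘L freeCoef h ∘L particularSol h

theorem projectedSol_apply (f : C(Icc (0 : ℝ) τ₀, ℝ)) :
    projectedSol h f = particularSol h f - regularSol h (freeCoef h (particularSol h f)) := rfl

theorem freeCoef_projectedSol (f : C(Icc (0 : ℝ) τ₀, ℝ)) : freeCoef h (projectedSol h f) = 0 := by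
  rw [projectedSol_apply, map_sub, (freeCoef_endCoef_regularSol h _).1, sub_self]

theorem endCoef_three_projectedSol (f : C(Icc (0 : ℝ) τ₀, ℝ)) :
    endCoef h 3 (projectedSol h f) = -radialMoment pc (IccExtend h.le f) τ₀ := by
  set M := radialMoment pc (IccExtend h.le f) τ₀
  set N := radialMoment qc (IccExtend h.le f) τ₀
  have hval : particularSol h f ⟨τ₀, right_mem_Icc.2 h.le⟩ 1 = pc τ₀ * N - qc τ₀ * M := by
    rw [← coord_apply, coord_particularSol]
    rfl
  have hderiv : particularSol h f ⟨τ₀, right_mem_Icc.2 h.le⟩ 3 = pc1 τ₀ * N - qc1 τ₀ * M := by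
    rw [← coord_apply, coord_particularSol]
    rfl
  rw [projectedSol_apply, map_sub, (freeCoef_endCoef_regularSol h _).2.2, sub_zero, endCoef_apply,
    frameCoef_apply]
  refine coefQ_eq h (x := N) ?_ ?_
  · rw [hval]
    ring
  · rw [hderiv]
    ring

theorem isCoreSolution_iff_eq {ν η lam : ℝ} {U : C(Icc (0 : ℝ) τ₀, E4)} :
    IsCoreSolution ν η lam h U ↔
      U = regularSol h (freeCoef h U) + projectedSol h (cubic ν η lam (coord τ₀ 0 U)) := by
  rw [isCoreSolution_iff_exists]
  set f := cubic ν η lam (coord τ₀ 0 U)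
  constructor
  · rintro ⟨x, hx⟩
    have hfree : freeCoef h U = x + freeCoef h (particularSol h f) := by
      rw [hx, map_add, (freeCoef_endCoef_regularSol h x).1]
    rw [hfree, projectedSol_apply, map_add, add_add_sub_cancel]
    exact hx
  · intro hU
    refine ⟨freeCoef h U - freeCoef h (particularSol h f), ?_⟩
    rw [map_sub, sub_add_eq_add_sub, add_sub_assoc]
    exact hU

end EndpointCoefficients

section CoefficientEstimates

theorem norm_E2_cube_le {d : E2} (hd : ‖d‖ ≤ 1) : ‖d‖ ^ 3 ≤ 4 * (|d 0| ^ 3 + |d 1| ^ 2) := by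
  have hle : ‖d‖ ≤ |d 0| + |d 1| := by
    rw [EuclideanSpace.norm_eq, Fin.sum_univ_two, Real.sqrt_le_left (by positivity)]
    simp only [Real.norm_eq_abs]
    linarith [add_sq |d 0| |d 1|, mul_nonneg (abs_nonneg (d 0)) (abs_nonneg (d 1))]
  have hd₁ : |d 1| ≤ 1 := (PiLp.norm_apply_le d 1).trans hd
  calc ‖d‖ ^ 3 ≤ (|d 0| + |d 1|) ^ 3 := by gcongr
    _ ≤ 2 ^ 2 * (|d 0| ^ 3 + |d 1| ^ 3) := add_pow_le (abs_nonneg _) (abs_nonneg _) 3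
    _ ≤ 4 * (|d 0| ^ 3 + |d 1| ^ 2) := by
      norm_num only
      gcongr ?_ * (_ + ?_)
      exact pow_le_pow_of_le_one (abs_nonneg _) hd₁ (by norm_num)

theorem map_add_smul_sq {X : Type*} [CommRing X] [Algebra ℝ X] (M : X →ₗ[ℝ] ℝ) (x y : ℝ)
    (P A : X) :
    M ((x • P + y • A) ^ 2) = x ^ 2 * M (P ^ 2) + 2 * (x * y) * M (P * A) + y ^ 2 * M (A ^ 2) := by
  have hsq : (x • P + y • A) ^ 2 = x ^ 2 • P ^ 2 + (2 * (x * y)) • (P * A) + y ^ 2 • A ^ 2 := by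
    simp only [Algebra.smul_def, map_pow, map_mul, map_ofNat]
    ring
  simp only [hsq, map_add, map_smul, smul_eq_mul]

variable {τ₀ : ℝ} (h : 0 < τ₀)

theorem endCoef_three_projectedSol_pMap_sq :
    endCoef h 3 (projectedSol h (legendreSystem.pMap τ₀ ^ 2)) =
      -∫ s in (0 : ℝ)..τ₀, pc s ^ 3 * Real.sinh s := by
  rw [endCoef_three_projectedSol]
  refine congrArg Neg.neg (intervalIntegral.integral_congr fun s hs => ?_)
  rw [uIcc_of_le h.le] at hs
  have hpow : IccExtend h.le (legendreSystem.pMap τ₀ ^ 2 : C(Icc (0 : ℝ) τ₀, ℝ)) s = pc s ^ 2 :=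
    IccExtend_of_mem h.le _ hs
  simp only [hpow]
  ring

theorem endCoef_three_projectedSol_regularSol_sq (d : E2) :
    endCoef h 3 (projectedSol h (coord τ₀ 0 (regularSol h d) ^ 2)) =
      -(d 0 ^ 2 * ∫ s in (0 : ℝ)..τ₀, pc s ^ 3 * Real.sinh s) +
        2 * (d 0 * d 1) * endCoef h 3
          (projectedSol h (legendreSystem.pMap τ₀ * green h (legendreSystem.pMap τ₀))) +
        d 1 ^ 2 * endCoef h 3 (projectedSol h (green h (legendreSystem.pMap τ₀) ^ 2)) := by
  rw [coord_regularSol, ← mul_neg, ← endCoef_three_projectedSol_pMap_sq h]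
  exact map_add_smul_sq ((endCoef h 3).comp (projectedSol h)).toLinearMap (d 0) (d 1) _ _

/-- A small solution of the core problem with free endpoint coefficients `d`. -/
abbrev IsSmallCoreSolution (ν η lam : ℝ) (d : E2) (U : C(Icc (0 : ℝ) τ₀, E4)) : Prop :=
  IsSmallSolution ν η lam (coord τ₀ 0) (projectedSol h) (regularSol h) d U

theorem exists_abs_endCoef_two_le (ν η : ℝ) : ∃ C ≥ 0, ∀ lam d U, ‖d‖ ≤ 1 →
    IsSmallCoreSolution h ν η lam d U → |endCoef h 2 U| ≤ C * (|lam| * ‖d‖ + ‖d‖ ^ 2) :=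
  IsSmallSolution.exists_norm_map_le ν η _ _ (endCoef h 2)
    fun d => (freeCoef_endCoef_regularSol h d).2.1

theorem exists_abs_endCoef_three_add_le (ν η : ℝ) : ∃ B ≥ 0, ∃ C ≥ 0, ∀ lam d U, ‖d‖ ≤ 1 →
    IsSmallCoreSolution h ν η lam d U →
    |endCoef h 3 U + (∫ s in (0 : ℝ)..τ₀, pc s ^ 3 * Real.sinh s) * ν * d 0 ^ 2| ≤
      |ν| * (2 * |d 0| * (B * |d 1|)) + C * (|lam| * ‖d‖ + |d 1| ^ 2 + |d 0| ^ 3) := by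
  set m := ∫ s in (0 : ℝ)..τ₀, pc s ^ 3 * Real.sinh s
  obtain ⟨C, hC, hexpand⟩ := IsSmallSolution.exists_norm_map_sub_le ν η (coord τ₀ 0)
    (projectedSol h) (endCoef h 3) fun d => (freeCoef_endCoef_regularSol h d).2.2
  set μ := endCoef h 3
    (projectedSol h (legendreSystem.pMap τ₀ * green h (legendreSystem.pMap τ₀)))
  set κ := endCoef h 3 (projectedSol h (green h (legendreSystem.pMap τ₀) ^ 2))
  refine ⟨|μ|, abs_nonneg _, 4 * C + |ν * κ|, by positivity, fun lam d U hd hU => ?_⟩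
  set E := endCoef h 3 U - ν * endCoef h 3 (projectedSol h (coord τ₀ 0 (regularSol h d) ^ 2))
    with hE
  have hremainder : |E| ≤ C * (|lam| * ‖d‖ + ‖d‖ ^ 3) := hexpand lam d U hd hU
  have hsplit : endCoef h 3 U + m * ν * d 0 ^ 2 =
      E + ν * (2 * d 0 * (μ * d 1)) + ν * κ * d 1 ^ 2 := by
    rw [hE, endCoef_three_projectedSol_regularSol_sq]
    ring
  have hcross : |ν * (2 * d 0 * (μ * d 1))| = |ν| * (2 * |d 0| * (|μ| * |d 1|)) := by
    simp only [abs_mul, abs_two]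
  have hsq : |ν * κ * d 1 ^ 2| = |ν * κ| * |d 1| ^ 2 := by rw [abs_mul, abs_pow]
  have hlam : 0 ≤ |lam| * ‖d‖ := by positivity
  have hd₀ : 0 ≤ |d 0| ^ 3 := by positivity
  calc _ ≤ |E| + |ν * (2 * d 0 * (μ * d 1))| + |ν * κ * d 1 ^ 2| := by
        rw [hsplit]
        exact abs_add_three _ _ _
    _ ≤ C * (|lam| * ‖d‖ + 4 * (|d 0| ^ 3 + |d 1| ^ 2)) +
        |ν| * (2 * |d 0| * (|μ| * |d 1|)) + |ν * κ| * |d 1| ^ 2 := by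
      rw [hcross, hsq]
      gcongr
      exact hremainder.trans (by gcongr; exact norm_E2_cube_le hd)
    _ ≤ _ := by
      linarith [mul_nonneg hC hlam, mul_nonneg (abs_nonneg (ν * κ)) hlam,
        mul_nonneg (abs_nonneg (ν * κ)) hd₀]

theorem exists_abs_endCoef_three_add_le_of_cross_term (ν η : ℝ) : ∃ C ≥ 0, ∀ lam d U, ‖d‖ ≤ 1 →
    IsSmallCoreSolution h ν η lam d U →
    |endCoef h 3 U + (∫ s in (0 : ℝ)..τ₀, pc s ^ 3 * Real.sinh s) * ν * d 0 ^ 2| ≤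
      C * (|lam| * ‖d‖ + |d 0| * |d 1| + |d 1| ^ 2 + |d 0| ^ 3) := by
  obtain ⟨B, hB, C, hC, hest⟩ := exists_abs_endCoef_three_add_le h ν η
  refine ⟨2 * |ν| * B + C, by positivity, fun lam d U hd hU => (hest lam d U hd hU).trans ?_⟩
  calc _ = 2 * |ν| * B * (|d 0| * |d 1|) + C * (|lam| * ‖d‖ + |d 1| ^ 2 + |d 0| ^ 3) := by ring
    _ ≤ 2 * |ν| * B * (|lam| * ‖d‖ + |d 0| * |d 1| + |d 1| ^ 2 + |d 0| ^ 3) +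
        C * (|lam| * ‖d‖ + |d 0| * |d 1| + |d 1| ^ 2 + |d 0| ^ 3) := by
      have : 0 ≤ |lam| * ‖d‖ + |d 1| ^ 2 + |d 0| ^ 3 := by positivity
      have : 0 ≤ |d 0| * |d 1| := by positivity
      gcongr <;> linarith
    _ = _ := by ring

theorem exists_abs_endCoef_three_add_calI_le (ν η : ℝ) {θ : ℝ} (hθ : 0 < θ) :
    ∃ C ≥ 0, ∀ lam d U, ‖d‖ ≤ 1 → IsSmallCoreSolution h ν η lam d U →
    |endCoef h 3 U + calI * ν * d 0 ^ 2| ≤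
      (|(∫ s in (0 : ℝ)..τ₀, pc s ^ 3 * Real.sinh s) - calI| + θ) * |ν| * d 0 ^ 2 +
        C * (|lam| * ‖d‖ + |d 1| ^ 2 + |d 0| ^ 3) := by
  obtain ⟨B, -, C, hC, hest⟩ := exists_abs_endCoef_three_add_le h ν η
  refine ⟨|ν| * θ⁻¹ * B ^ 2 + C, by positivity, fun lam d U hd hU => ?_⟩
  set m := ∫ s in (0 : ℝ)..τ₀, pc s ^ 3 * Real.sinh s
  have hcross : 2 * |d 0| * (B * |d 1|) ≤ θ * d 0 ^ 2 + θ⁻¹ * (B * |d 1|) ^ 2 := by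
    simpa only [sq_abs] using two_mul_le_add_mul_sq (a := |d 0|) (b := B * |d 1|) hθ
  have hsplit : endCoef h 3 U + calI * ν * d 0 ^ 2 =
      (endCoef h 3 U + m * ν * d 0 ^ 2) - (m - calI) * ν * d 0 ^ 2 := by ring
  have hdiff : |(m - calI) * ν * d 0 ^ 2| = |m - calI| * |ν| * d 0 ^ 2 := by
    rw [abs_mul, abs_mul, abs_pow, sq_abs]
  have hnonneg : 0 ≤ |ν| * θ⁻¹ * B ^ 2 * (|lam| * ‖d‖ + |d 0| ^ 3) := by positivity
  calc _ ≤ |endCoef h 3 U + m * ν * d 0 ^ 2| + |m - calI| * |ν| * d 0 ^ 2 := by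
        rw [hsplit, ← hdiff]
        exact abs_sub _ _
    _ ≤ |ν| * (θ * d 0 ^ 2 + θ⁻¹ * (B * |d 1|) ^ 2) +
          C * (|lam| * ‖d‖ + |d 1| ^ 2 + |d 0| ^ 3) + |m - calI| * |ν| * d 0 ^ 2 := by
      gcongr
      exact (hest lam d U hd hU).trans (by gcongr)
    _ ≤ _ := by linarith

theorem exists_coefficient_estimates (ν η : ℝ) {θ : ℝ} (hθ : 0 < θ) :
    ∃ C, ∀ lam d U, ‖d‖ ≤ 1 → IsSmallCoreSolution h ν η lam d U →
      |endCoef h 2 U| ≤ C * (|lam| * ‖d‖ + ‖d‖ ^ 2) ∧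
      |endCoef h 3 U + (∫ s in (0 : ℝ)..τ₀, pc s ^ 3 * Real.sinh s) * ν * d 0 ^ 2| ≤
        C * (|lam| * ‖d‖ + |d 0| * |d 1| + |d 1| ^ 2 + |d 0| ^ 3) ∧
      |endCoef h 3 U + calI * ν * d 0 ^ 2| ≤
        (|(∫ s in (0 : ℝ)..τ₀, pc s ^ 3 * Real.sinh s) - calI| + θ) * |ν| * d 0 ^ 2 +
          C * (|lam| * ‖d‖ + |d 1| ^ 2 + |d 0| ^ 3) := by
  obtain ⟨C₁, hC₁, h₁⟩ := exists_abs_endCoef_two_le h ν η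
  obtain ⟨C₂, hC₂, h₂⟩ := exists_abs_endCoef_three_add_le_of_cross_term h ν η
  obtain ⟨C₃, hC₃, h₃⟩ := exists_abs_endCoef_three_add_calI_le h ν η hθ
  refine ⟨C₁ + C₂ + C₃, fun lam d U hd hU => ⟨(h₁ lam d U hd hU).trans ?_,
    (h₂ lam d U hd hU).trans ?_, (h₃ lam d U hd hU).trans ?_⟩⟩ <;> gcongr <;> linarith

end CoefficientEstimates

section CoreManifold

theorem isSmoothSubmanifold_image_of_leftInverse {X : Type*} [NormedAddCommGroup X]
    [NormedSpace ℝ X] {n : ℕ} {D : Set (EuclideanSpace ℝ (Fin n))}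
    {φ : EuclideanSpace ℝ (Fin n) → X} (κ : X →L[ℝ] EuclideanSpace ℝ (Fin n)) (hD : IsOpen D)
    (hφ : ContDiffOn ℝ ∞ φ D) (hκ : ∀ y ∈ D, κ (φ y) = y) : IsSmoothSubmanifold n (φ '' D) := by
  intro p _
  refine ⟨univ, D, φ, κ, isOpen_univ, mem_univ _, hD, hφ, fun y hy => ?_, (inter_univ _).symm,
    κ.continuous.continuousOn, hκ⟩
  have hφy : DifferentiableAt ℝ φ y := (hφ.contDiffAt (hD.mem_nhds hy)).differentiableAt (by simp)
  have hκφ : HasFDerivAt (κ ∘ φ) (.id ℝ _) y :=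
    (hasFDerivAt_id y).congr_of_eventuallyEq (eventually_of_mem (hD.mem_nhds hy) hκ)
  have hcomp := (κ.hasFDerivAt.comp y hφy.hasFDerivAt).unique hκφ
  exact Function.LeftInverse.injective (g := κ) fun v => congr($hcomp v)

theorem exists_pos_le_and_mul_lt {r s : ℝ} (hr : 0 < r) (hs : 0 < s) (M : ℝ) :
    ∃ δ > 0, δ ≤ r ∧ M * δ < s := by
  have hlim : Tendsto (M * ·) (𝓝[>] 0) (𝓝 0) :=
    (Continuous.tendsto' (by fun_prop) _ _ (mul_zero M)).mono_left nhdsWithin_le_nhds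
  have hmem : ∀ᶠ δ in 𝓝[>] 0, δ ∈ Ioc 0 r := Ioc_mem_nhdsGT hr
  obtain ⟨δ, ⟨hδ, hδr⟩, hlt⟩ := (hmem.and (hlim.eventually_lt_const hs)).exists
  exact ⟨δ, hδ, hδr, hlt⟩

variable {τ₀ : ℝ} {h : 0 < τ₀} {ν η lam : ℝ}

theorem IsSmallSolution.freeCoef_eq {d : E2} {U : C(Icc (0 : ℝ) τ₀, E4)}
    (hU : IsSmallCoreSolution h ν η lam d U) : freeCoef h U = d := by
  rw [hU.eq, map_add, (freeCoef_endCoef_regularSol h d).1, freeCoef_projectedSol, add_zero]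

theorem IsSmallSolution.isCoreSolution {d : E2} {U : C(Icc (0 : ℝ) τ₀, E4)}
    (hU : IsSmallCoreSolution h ν η lam d U) : IsCoreSolution ν η lam h U := by
  rw [isCoreSolution_iff_eq, hU.freeCoef_eq]
  exact hU.eq

theorem isSmoothSubmanifold_coreManifold {δ₀ r : ℝ} {φ : E2 → C(Icc (0 : ℝ) τ₀, E4)}
    (hφ : ContDiffOn ℝ ∞ φ (Metric.ball 0 r))
    (hsol : ∀ d ∈ Metric.ball 0 r, IsSmallCoreSolution h ν η lam d (φ d))
    (huniq : ∀ U ∈ coreManifold ν η lam h δ₀,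
      freeCoef h U ∈ Metric.ball 0 r ∧ U = φ (freeCoef h U)) :
    IsSmoothSubmanifold 2 (coreManifold ν η lam h δ₀) := by
  have himage : φ '' (Metric.ball 0 r ∩ φ ⁻¹' Metric.ball 0 δ₀) = coreManifold ν η lam h δ₀ := by
    ext U
    constructor
    · rintro ⟨d, ⟨hd, hsmall⟩, rfl⟩
      exact ⟨(hsol d hd).isCoreSolution, mem_ball_zero_iff.1 hsmall⟩
    · intro hU
      obtain ⟨hball, heq⟩ := huniq U hU
      refine ⟨freeCoef h U, ⟨hball, ?_⟩, heq.symm⟩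
      rw [mem_preimage, ← heq]
      exact mem_ball_zero_iff.2 hU.2
  rw [← himage]
  exact isSmoothSubmanifold_image_of_leftInverse (freeCoef h)
    (hφ.continuousOn.isOpen_inter_preimage Metric.isOpen_ball Metric.isOpen_ball)
    (hφ.mono inter_subset_left) fun d hd => (hsol d hd.1).freeCoef_eq

variable (h ν η) in
theorem exists_coreManifold_parametrization :
    ∃ δ₀ > 0, ∃ δ₁ > 0, δ₁ ≤ 1 ∧ ∃ Φ : E2 × ℝ → C(Icc (0 : ℝ) τ₀, E4),
      ContDiffOn ℝ ∞ Φ (Metric.ball 0 δ₁ ×ˢ Ioo (-δ₀) δ₀) ∧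
      (∀ lam, |lam| < δ₀ → IsSmoothSubmanifold 2 (coreManifold ν η lam h δ₀)) ∧
      ∀ d lam, ‖d‖ < δ₁ → |lam| < δ₀ → IsSmallCoreSolution h ν η lam d (Φ (d, lam)) ∧
        Φ (d, lam) ∈ coreManifold ν η lam h δ₀ ∧
        ∀ U ∈ coreManifold ν η lam h δ₀, freeCoef h U = d → U = Φ (d, lam) := by
  obtain ⟨R, hR, r, hr, Φ, hΦ, hsol⟩ :=
    exists_contDiffOn_cubic_fixedPoint ν η (coord τ₀ 0) (projectedSol h) (regularSol h)
  obtain ⟨δ₀, hδ₀, hδ₀_le, hδ₀_lt⟩ := exists_pos_le_and_mul_lt (lt_min hR hr) hr ‖freeCoef h‖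
  obtain ⟨δ₁, hδ₁, hδ₁_le, hδ₁_lt⟩ :=
    exists_pos_le_and_mul_lt (lt_min one_pos hr) hδ₀ (2 * ‖regularSol h‖)
  obtain ⟨hδ₀R, hδ₀r⟩ := le_min_iff.1 hδ₀_le
  obtain ⟨hδ₁_one, hδ₁r⟩ := le_min_iff.1 hδ₁_le
  have hball {d : E2} {lam : ℝ} (hd : ‖d‖ < r) (hlam : |lam| < δ₀) :
      (d, lam) ∈ Metric.ball (0 : E2 × ℝ) r :=
    mem_ball_zero_iff.2 (max_lt hd (hlam.trans_le hδ₀r))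
  have huniq {lam : ℝ} (hlam : |lam| < δ₀) {U : C(Icc (0 : ℝ) τ₀, E4)}
      (hU : U ∈ coreManifold ν η lam h δ₀) :
      ‖freeCoef h U‖ < r ∧ U = Φ (freeCoef h U, lam) := by
    have hfree : ‖freeCoef h U‖ < r :=
      ((freeCoef h).le_opNorm_of_le hU.2.le).trans_lt hδ₀_lt
    exact ⟨hfree, (hsol _ (hball hfree hlam)).2 U (hU.2.trans_le hδ₀R)
      ((isCoreSolution_iff_eq h).1 hU.1)⟩
  refine ⟨δ₀, hδ₀, δ₁, hδ₁, hδ₁_one, Φ, ?_, fun lam hlam => ?_, fun d lam hd hlam => ?_⟩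
  · refine (hΦ.of_le (by simp)).mono fun q hq => ?_
    exact hball ((mem_ball_zero_iff.1 hq.1).trans_le hδ₁r) (abs_lt.2 hq.2)
  · refine isSmoothSubmanifold_coreManifold (φ := fun d => Φ (d, lam)) (r := r) ?_
      (fun d hd => (hsol _ (hball (mem_ball_zero_iff.1 hd) hlam)).1) fun U hU =>
      ⟨mem_ball_zero_iff.2 (huniq hlam hU).1, (huniq hlam hU).2⟩
    exact (hΦ.of_le (by simp)).comp (by fun_prop) fun d hd => hball (mem_ball_zero_iff.1 hd) hlam
  · have hΦd := (hsol _ (hball (hd.trans_le hδ₁r) hlam)).1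
    have hsmall : ‖Φ (d, lam)‖ < δ₀ := by
      have hT : ‖regularSol h d‖ ≤ ‖regularSol h‖ * δ₁ := (regularSol h).le_opNorm_of_le hd.le
      linarith [hΦd.norm_le]
    exact ⟨hΦd, ⟨hΦd.isCoreSolution, hsmall⟩, fun U hU hUd => hUd ▸ (huniq hlam hU).2⟩

variable (h) in
theorem mem_coreManifold_and_coreProj_eq_iff {δ₀ : ℝ} {d : E2} {U V : C(Icc (0 : ℝ) τ₀, E4)}
    (hV : V ∈ coreManifold ν η lam h δ₀) (hVd : freeCoef h V = d)
    (huniq : ∀ W ∈ coreManifold ν η lam h δ₀, freeCoef h W = d → W = V)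
    (hU : IsCoreSolution ν η lam h U) :
    (U ∈ coreManifold ν η lam h δ₀ ∧
        coreProj τ₀ (U ⟨τ₀, right_mem_Icc.2 h.le⟩) = d 0 • V1 τ₀ + d 1 • V2 τ₀) ↔
      U ⟨τ₀, right_mem_Icc.2 h.le⟩ =
        d 0 • V1 τ₀ + d 1 • V2 τ₀ + endCoef h 2 V • V3 τ₀ + endCoef h 3 V • V4 τ₀ := by
  have hVend := (endpoint_eq_iff h).2 ⟨hVd, rfl, rfl⟩
  rw [coreProj_endpoint_eq_iff h]
  constructor
  · rintro ⟨hUW, hUd⟩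
    rw [huniq U hUW hUd]
    exact hVend
  · intro hUend
    rw [IsCoreSolution.eq_of_endpoint h hU hV.1 (hUend.trans hVend.symm)]
    exact ⟨hV, hVd⟩

theorem tendsto_abs_integral_sub_calI_add : Tendsto (fun τ : ℝ =>
    |(∫ s in (0 : ℝ)..τ, pc s ^ 3 * Real.sinh s) - calI| + 1 / (1 + |τ|)) atTop (𝓝 0) := by
  have hinv : Tendsto (fun τ : ℝ => 1 / (1 + |τ|)) atTop (𝓝 0) :=
    tendsto_const_nhds.div_atTop (tendsto_atTop_add_const_left _ _ tendsto_abs_atTop_atTop)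
  simpa only [abs_zero, add_zero] using tendsto_integral_pc_cube_sub_calI.abs.add hinv

end CoreManifold

end HyperbolicSH

end

theorem mainTheorem10 (ν η : ℝ) :
    -- the integral defining `𝓘` converges
    IntegrableOn (fun s : ℝ => HyperbolicSH.pc s ^ 3 * Real.sinh s) (Ioi 0) ∧
    -- `ρ` and `ε` are the `o(1)` terms, as `τ₀ → ∞`
    ∃ ρ ε : ℝ → ℝ, Tendsto ρ atTop (𝓝 0) ∧ Tendsto ε atTop (𝓝 0) ∧
    ∀ (τ₀ : ℝ) (hτ₀ : 0 < τ₀),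
      -- the projection `coreProj τ₀` is well defined
      LinearIndependent ℝ (HyperbolicSH.frame τ₀) ∧
      ∃ (δ₀ δ₁ C : ℝ) (b a : HyperbolicSH.E2 × ℝ → ℝ), 0 < δ₀ ∧ 0 < δ₁ ∧
        (∀ lam : ℝ, |lam| < δ₀ →
          HyperbolicSH.IsSmoothSubmanifold 2 (HyperbolicSH.coreManifold ν η lam hτ₀ δ₀)) ∧
        -- `b` and `a` are the coefficients of `V₃(τ₀)` and `V₄(τ₀)`
        ContDiffOn ℝ ∞ b (Metric.ball 0 δ₁ ×ˢ Ioo (-δ₀) δ₀) ∧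
        ContDiffOn ℝ ∞ a (Metric.ball 0 δ₁ ×ˢ Ioo (-δ₀) δ₀) ∧
        (∀ (d : HyperbolicSH.E2) (lam : ℝ), ‖d‖ < δ₁ → |lam| < δ₀ →
          |b (d, lam)| ≤ C * (|lam| * ‖d‖ + ‖d‖ ^ 2) ∧
          |a (d, lam) + (HyperbolicSH.calI + ρ τ₀) * ν * d 0 ^ 2| ≤
            C * (|lam| * ‖d‖ + |d 0| * |d 1| + |d 1| ^ 2 + |d 0| ^ 3) ∧
          |a (d, lam) + HyperbolicSH.calI * ν * d 0 ^ 2| ≤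
            ε τ₀ * |ν| * d 0 ^ 2 + C * (|lam| * ‖d‖ + |d 1| ^ 2 + |d 0| ^ 3)) ∧
        (∀ (d : HyperbolicSH.E2) (lam : ℝ), ‖d‖ < δ₁ → |lam| < δ₀ →
          (∀ U : C(Icc (0 : ℝ) τ₀, HyperbolicSH.E4),
            HyperbolicSH.IsCoreSolution ν η lam hτ₀ U →
            ((U ∈ HyperbolicSH.coreManifold ν η lam hτ₀ δ₀ ∧
                HyperbolicSH.coreProj τ₀ (U ⟨τ₀, right_mem_Icc.2 hτ₀.le⟩) =
                  d 0 • HyperbolicSH.V1 τ₀ + d 1 • HyperbolicSH.V2 τ₀) ↔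
              U ⟨τ₀, right_mem_Icc.2 hτ₀.le⟩ =
                d 0 • HyperbolicSH.V1 τ₀ + d 1 • HyperbolicSH.V2 τ₀
                  + b (d, lam) • HyperbolicSH.V3 τ₀ + a (d, lam) • HyperbolicSH.V4 τ₀)) ∧
          ∃ U ∈ HyperbolicSH.coreManifold ν η lam hτ₀ δ₀,
            U ⟨τ₀, right_mem_Icc.2 hτ₀.le⟩ =
              d 0 • HyperbolicSH.V1 τ₀ + d 1 • HyperbolicSH.V2 τ₀
                + b (d, lam) • HyperbolicSH.V3 τ₀ + a (d, lam) • HyperbolicSH.V4 τ₀) := by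
  refine ⟨HyperbolicSH.integrableOn_pc_cube_mul_sinh, _, _,
    HyperbolicSH.tendsto_integral_pc_cube_sub_calI, HyperbolicSH.tendsto_abs_integral_sub_calI_add,
    fun τ₀ h => ⟨HyperbolicSH.linearIndependent_frame h, ?_⟩⟩
  obtain ⟨δ₀, hδ₀, δ₁, hδ₁, hδ₁_le, Φ, hΦ, hmanifold, hsol⟩ :=
    HyperbolicSH.exists_coreManifold_parametrization h ν η
  obtain ⟨C, hC⟩ := HyperbolicSH.exists_coefficient_estimates h ν η
    (θ := 1 / (1 + |τ₀|)) (by positivity)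
  refine ⟨δ₀, δ₁, C, fun q => HyperbolicSH.endCoef h 2 (Φ q),
    fun q => HyperbolicSH.endCoef h 3 (Φ q), hδ₀, hδ₁, hmanifold,
    (HyperbolicSH.endCoef h 2).contDiff.comp_contDiffOn hΦ,
    (HyperbolicSH.endCoef h 3).contDiff.comp_contDiffOn hΦ,
    fun d lam hd hlam => ?_, fun d lam hd hlam => ?_⟩ <;>
    obtain ⟨hsmall, hmem, huniq⟩ := hsol d lam hd hlam
  · simpa only [add_sub_cancel] using hC lam d (Φ (d, lam)) (hd.le.trans hδ₁_le) hsmall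
  · exact ⟨fun U => HyperbolicSH.mem_coreManifold_and_coreProj_eq_iff h hmem hsmall.freeCoef_eq
      huniq, Φ (d, lam), hmem, (HyperbolicSH.endpoint_eq_iff h).2 ⟨hsmall.freeCoef_eq, rfl, rfl⟩⟩
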